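/- Let $\mathbb{D}=\{z\in\mathbb{C}:|z|<1\}$. For a complex-valued harmonic function $f$ on $\mathbb{D}$ put $\Lambda_f(z)=|f_z(z)|+|f_{\bar z}(z)|$, where $f_z=\frac12(f_x-if_y)$ and $f_{\bar z}=\frac12(f_x+if_y)$. For $1<p<\infty$, the harmonic Hardy space $\mathscr{H}^p_H(\mathbb{D})$ consists of all complex-valued harmonic functions $f$ on $\mathbb{D}$ with $$\|f\|_p=\sup_{0<r<1}\Big(\frac1{2\pi}\int_0^{2\pi}|f(re^{i\theta})|^p\,d\theta\Big)^{1/p}<\infty .$$ A majorant is a continuous increasing (not necessarily strictly) function $\omega:[0,\infty)\to[0,\infty)$ with $\omega(0)=0$ such that $\omega(t)/t$ is non-increasing for $t>0$. For $\alpha>0$, $\beta\in\mathbb{R}$ and a majorant $\omega$, the harmonic Bloch type space $\mathscr{B}^{\alpha,\beta}_{H_\omega}$ consists of all complex-valued harmonic functions $f$ on $\mathbb{D}$ with $$\|f\|_{\mathscr{B}^{\alpha,\beta}_{H_\omega}}=|f(0)|+\sup_{z\in\mathbb{D}}\Lambda_f(z)\,\omega\Big((1-|z|^2)^\alpha\Big(\log\frac{e}{1-|z|^2}\Big)^\beta\Big)<\infty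 .$$ **Theorem.** Let $p\in(1,\infty)$, let $\omega$ be a majorant such that $\lim_{t\to0^+}\omega(t)/t$ exists and is finite, let $\phi:\mathbb{D}\to\mathbb{D}$ be analytic, and let either $\alpha=1$ and $\beta\le0$, or $\alpha>1$ and $\beta\in\mathbb{R}$. Let $C_\phi(f)=f\circ\phi$ and $$Q(z)=\frac{|\phi'(z)|\,\omega\Big((1-|z|^2)^\alpha\big(\log\frac{e}{1-|z|^2}\big)^\beta\Big)}{(1-|\phi(z)|^2)^{1+\frac1p}},\qquad z\in\mathbb{D}.$$ 1. $C_\phi:\mathscr{H}^p_H(\mathbb{D})\to\mathscr{B}^{\alpha,\beta}_{H_\omega}$ is a bounded operator (that is, it maps the first space into the second, and $\|C_\phi f\|_{\mathscr{B}^{\alpha,\beta}_{H_\omega}}\le C\|f\|_p$ for some constant $C$ and all $f$) if and only if $\sup_{z\in\mathbb{D}}Q(z)<\infty$. 2. $C_\phi:\mathscr{H}^p_H(\mathbb{D})\to\mathscr{B}^{\alpha,\beta}_{H_\omega}$ is a compact operator (that is, it maps the first space into the second, and the image of every bounded sequence has a subsequence converging in the norm of $\mathscr{B}^{\alpha,\beta}_{H_\omega}$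 to an element of that space) if and only if $\lim_{|\phi(z)|\to1}Q(z)=0$, i.e. for every $\varepsilon>0$ there is $r<1$ such that $Q(z)<\varepsilon$ for all $z\in\mathbb{D}$ with $|\phi(z)|>r$ (a vacuous condition if $\sup_{\mathbb{D}}|\phi|<1$). -/

import Mathlib

open Set Filter Topology MeasureTheory
open scoped NNReal ENNReal

noncomputable section

/-- The open unit disk of the complex plane. -/
def unitDisk : Set ℂ := Metric.ball 0 1

/-- A majorant: a continuous increasing `ω : [0, ∞) → [0, ∞)` with `ω 0 = 0` such that `ω t / t` is
non-increasing for `t > 0`. Only the values on `[0, ∞)` matter; they are nonnegative by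
monotonicity. -/
structure IsMajorant (ω : ℝ → ℝ) : Prop where
  continuousOn : ContinuousOn ω (Ici 0)
  monotoneOn : MonotoneOn ω (Ici 0)
  map_zero : ω 0 = 0
  antitoneOn_div : AntitoneOn (fun t => ω t / t) (Ioi 0)

/-- Complex-valued harmonic functions on the unit disk. -/
def IsHarmonicOnDisk (f : ℂ → ℂ) : Prop := InnerProductSpace.HarmonicOnNhd f unitDisk

/-- The formal derivative `f_z = (f_x - i f_y) / 2`. -/
def dz (f : ℂ → ℂ) (z : ℂ) : ℂ :=
  (1 / 2 : ℂ) * (fderiv ℝ f z 1 - Complex.I * fderiv ℝ f z Complex.I)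

/-- The formal derivative `f_{z̄} = (f_x + i f_y) / 2`. -/
def dzbar (f : ℂ → ℂ) (z : ℂ) : ℂ :=
  (1 / 2 : ℂ) * (fderiv ℝ f z 1 + Complex.I * fderiv ℝ f z Complex.I)

/-- `Λ_f(z) = |f_z(z)| + |f_{z̄}(z)|`, the largest modulus of a directional derivative of `f`
at `z`. -/
def bigLambda (f : ℂ → ℂ) (z : ℂ) : ℝ := ‖dz f z‖ + ‖dzbar f z‖

/-- The integral mean `M_p(r, f)`, for `0 < p < ∞`. -/
def integralMean (p r : ℝ) (f : ℂ → ℂ) : ℝ≥0∞ :=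
  (ENNReal.ofReal (1 / (2 * Real.pi)) *
    ∫⁻ θ in Icc 0 (2 * Real.pi), ‖f (circleMap 0 r θ)‖ₑ ^ p) ^ (1 / p)

/-- The Hardy norm `‖f‖_p = sup_{0 < r < 1} M_p(r, f)`, with value `∞` allowed. -/
def hardyNorm (p : ℝ) (f : ℂ → ℂ) : ℝ≥0∞ := ⨆ r ∈ Ioo (0 : ℝ) 1, integralMean p r f

/-- The harmonic Hardy space. -/
def harmonicHardy (p : ℝ) : Set (ℂ → ℂ) := {f | IsHarmonicOnDisk f ∧ hardyNorm p f < ∞}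

/-- The weight `ω((1 - |z|²)^α (log (e / (1 - |z|²)))^β)`. -/
def blochWeight (ω : ℝ → ℝ) (α β : ℝ) (z : ℂ) : ℝ :=
  ω ((1 - ‖z‖ ^ 2) ^ α * Real.log (Real.exp 1 / (1 - ‖z‖ ^ 2)) ^ β)

/-- The Bloch type norm `|f(0)| + sup_{|z| < 1} Λ_f(z) ω(…)`, with value `∞` allowed. -/
def blochNorm (ω : ℝ → ℝ) (α β : ℝ) (f : ℂ → ℂ) : ℝ≥0∞ :=
  ‖f 0‖ₑ + ⨆ z ∈ unitDisk, ENNReal.ofReal (bigLambda f z * blochWeight ω α β z)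

/-- The harmonic Bloch type space. -/
def harmonicBloch (ω : ℝ → ℝ) (α β : ℝ) : Set (ℂ → ℂ) :=
  {f | IsHarmonicOnDisk f ∧ blochNorm ω α β f < ∞}

/-- The composition operator `C_φ f = f ∘ φ`. -/
def compOp (φ : ℂ → ℂ) (f : ℂ → ℂ) : ℂ → ℂ := f ∘ φ

/-- `T` is a bounded operator from the space `X` with norm `NX` to the space `Y` with norm `NY`. -/
def IsBoundedOp (X : Set (ℂ → ℂ)) (NX : (ℂ → ℂ) → ℝ≥0∞) (Y : Set (ℂ → ℂ))
    (NY : (ℂ → ℂ) → ℝ≥0∞) (T : (ℂ → ℂ) → (ℂ → ℂ)) : Prop :=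
  MapsTo T X Y ∧ ∃ C : ℝ≥0, ∀ f ∈ X, NY (T f) ≤ C * NX f

/-- `T` is a compact operator from the space `X` with norm `NX` to the space `Y` with norm `NY`:
it maps `X` into `Y`, and the image of every bounded sequence has a subsequence that converges in
`Y`. -/
def IsCompactOp (X : Set (ℂ → ℂ)) (NX : (ℂ → ℂ) → ℝ≥0∞) (Y : Set (ℂ → ℂ))
    (NY : (ℂ → ℂ) → ℝ≥0∞) (T : (ℂ → ℂ) → (ℂ → ℂ)) : Prop :=
  MapsTo T X Y ∧
    ∀ u : ℕ → ℂ → ℂ, (∀ n, u n ∈ X) → (∃ M : ℝ≥0, ∀ n, NX (u n) ≤ M) →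
      ∃ g ∈ Y, ∃ σ : ℕ → ℕ, StrictMono σ ∧
        Tendsto (fun n => NY (T (u (σ n)) - g)) atTop (𝓝 0)

/-- The quantity `|φ'(z)| ω((1 - |z|²)^α (log (e / (1 - |z|²)))^β) / (1 - |φ(z)|²)^(1 + 1/p)`. -/
def compQuantity (p : ℝ) (ω : ℝ → ℝ) (α β : ℝ) (φ : ℂ → ℂ) (z : ℂ) : ℝ :=
  ‖deriv φ z‖ * blochWeight ω α β z / (1 - ‖φ z‖ ^ 2) ^ (1 + 1 / p)

end

/-!
A complex-valued harmonic function on the disk is `f = h + conj g` with `h`, `g` holomorphic, and then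
`Λ_f = |h'| + |g'|`. Consequently `Λ_{f ∘ φ}(z) = Λ_f(φ z) |φ' z|` (`bigLambda_compOp`), and everything
depends on how large `Λ_f` may be for `f` in the Hardy space.

*Upper bound.* Poisson's formula gives `|f(w)| ≤ C ‖f‖_p (1 - |w|)^(-1/p)`
(`norm_le_of_hardyNorm_le`), and Cauchy's estimate turns it into
`Λ_f(w) ≤ C ‖f‖_p (1 - |w|²)^(-1-1/p)` (`bigLambda_le_of_hardyNorm_le`). Hence
`Λ_{f ∘ φ}(z) ω(…) ≤ C ‖f‖_p Q(z)`, which settles the sufficiency for boundedness.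

*Lower bound.* The functions `((1 - |a|²) / (1 - ā z)²)^(1/p)` lie in the unit ball of the Hardy space
and attain this order of growth at `a`, up to the factor `|a|` (`bigLambda_hardyTestFun_self`). With
`a = φ z` they bound `|φ z| Q(z)`. The points where `|φ z|` stays away from `1` play no role:
`ω(t) = O(t)`, the restriction on `α`, `β` and the Schwarz lemma make `|φ'| ω(…)` bounded on the disk
(`exists_norm_deriv_mul_blochWeight_le`).

*Compactness.* By Montel's theorem a bounded sequence in the Hardy space has a subsequence converging
locally uniformly together with its gradients (`exists_subseq_of_hardyNorm_le`). This controls the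
points with `|φ z| ≤ r`, and the smallness of `Q` controls the others. Conversely, if `Q` does not
tend to `0` as `|φ z| → 1`, the test functions with poles `φ (z n)` converge to `0` together with
their gradients pointwise, while the norms of their images are bounded below, so that no subsequence
of the images converges (`forall_compQuantity_lt_of_isCompactOp`).
-/

open scoped ComplexConjugate

/-! ### Splitting a harmonic function into a holomorphic and an antiholomorphic part -/

/-- `f = h + conj g` on the unit disk with `h` and `g` holomorphic there. No normalization such as
`g 0 = 0` is imposed. -/
structure IsHarmonicSplitting (f h g : ℂ → ℂ) : Prop where
  left : DifferentiableOn ℂ h unitDisk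
  right : DifferentiableOn ℂ g unitDisk
  eqOn : EqOn f (fun z => h z + conj (g z)) unitDisk

theorem isOpen_unitDisk : IsOpen unitDisk := Metric.isOpen_ball

theorem mem_unitDisk {z : ℂ} : z ∈ unitDisk ↔ ‖z‖ < 1 := mem_ball_zero_iff

theorem one_sub_norm_sq_pos {z : ℂ} (hz : z ∈ unitDisk) : 0 < 1 - ‖z‖ ^ 2 := by
  have := mem_unitDisk.1 hz
  nlinarith [norm_nonneg z]

theorem one_sub_norm_sq_le {z : ℂ} (hz : z ∈ unitDisk) : 1 - ‖z‖ ^ 2 ≤ 2 * (1 - ‖z‖) := by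
  have := mem_unitDisk.1 hz
  nlinarith [norm_nonneg z]

theorem exists_isHarmonicSplitting {f : ℂ → ℂ} (hf : IsHarmonicOnDisk f) :
    ∃ h g, IsHarmonicSplitting f h g ∧ g 0 = 0 := by
  obtain ⟨F, hF, hFre⟩ := InnerProductSpace.HarmonicOnNhd.exists_analyticOnNhd_ball_re_eq
    (InnerProductSpace.HarmonicOnNhd.comp_CLM hf Complex.reCLM)
  obtain ⟨G, hG, hGre⟩ := InnerProductSpace.HarmonicOnNhd.exists_analyticOnNhd_ball_re_eq
    (InnerProductSpace.HarmonicOnNhd.comp_CLM hf Complex.imCLM)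
  have hF' : DifferentiableOn ℂ F unitDisk := hF.differentiableOn
  have hG' : DifferentiableOn ℂ G unitDisk := hG.differentiableOn
  -- the additive constant is moved from `g` to `h`, which makes `g 0 = 0`
  set c : ℂ := (F 0 - Complex.I * G 0) / 2 with hc
  refine ⟨fun z => (F z + Complex.I * G z) / 2 + conj c,
    fun z => (F z - Complex.I * G z) / 2 - c, ⟨?_, ?_, ?_⟩, by simp [hc]⟩
  · fun_prop
  · fun_prop
  · intro z hz
    have h1 : (F z).re = (f z).re := hFre hz
    have h2 : (G z).re = (f z).im := hGre hz
    have e : (F z + Complex.I * G z) / 2 + conj c + conj ((F z - Complex.I * G z) / 2 - c) =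
        (F z + conj (F z)) / 2 + Complex.I * ((G z + conj (G z)) / 2) := by
      simp only [map_sub, map_div₀, map_mul, Complex.conj_I, map_ofNat]
      ring
    simp only [e, Complex.add_conj, h1, h2]
    conv_lhs => rw [← Complex.re_add_im (f z)]
    push_cast
    ring

namespace IsHarmonicSplitting

variable {f f₁ h g h₁ g₁ : ℂ → ℂ}

theorem isHarmonicOnDisk (S : IsHarmonicSplitting f h g) : IsHarmonicOnDisk f := by
  intro z hz
  have hh : AnalyticAt ℂ h z := S.left.analyticAt (isOpen_unitDisk.mem_nhds hz)
  have hg : AnalyticAt ℂ g z := S.right.analyticAt (isOpen_unitDisk.mem_nhds hz)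
  have h2 : InnerProductSpace.HarmonicAt (fun z => conj (g z)) z :=
    hg.harmonicAt.comp_CLM (Complex.conjCLE : ℂ →L[ℝ] ℂ)
  exact (InnerProductSpace.harmonicAt_congr_nhds
    (S.eqOn.eventuallyEq_of_mem (isOpen_unitDisk.mem_nhds hz))).2 (hh.harmonicAt.add h2)

theorem hasFDerivAt (S : IsHarmonicSplitting f h g) {z : ℂ} (hz : z ∈ unitDisk) :
    HasFDerivAt f (((deriv h z) • (1 : ℂ →L[ℂ] ℂ)).restrictScalars ℝ +
      (Complex.conjCLE : ℂ →L[ℝ] ℂ).comp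
        (((deriv g z) • (1 : ℂ →L[ℂ] ℂ)).restrictScalars ℝ)) z := by
  have hh := (S.left.differentiableAt (isOpen_unitDisk.mem_nhds hz)).hasDerivAt
  have hg := (S.right.differentiableAt (isOpen_unitDisk.mem_nhds hz)).hasDerivAt
  have h1 := hh.complexToReal_fderiv.add
    ((Complex.conjCLE : ℂ →L[ℝ] ℂ).hasFDerivAt.comp z hg.complexToReal_fderiv)
  exact h1.congr_of_eventuallyEq (S.eqOn.eventuallyEq_of_mem (isOpen_unitDisk.mem_nhds hz))

theorem dz_eq (S : IsHarmonicSplitting f h g) {z : ℂ} (hz : z ∈ unitDisk) :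
    dz f z = deriv h z := by
  rw [dz, (S.hasFDerivAt hz).fderiv]
  simp
  ring_nf
  simp
  ring

theorem dzbar_eq (S : IsHarmonicSplitting f h g) {z : ℂ} (hz : z ∈ unitDisk) :
    dzbar f z = conj (deriv g z) := by
  rw [dzbar, (S.hasFDerivAt hz).fderiv]
  simp
  ring_nf
  simp
  ring

theorem bigLambda_eq (S : IsHarmonicSplitting f h g) {z : ℂ} (hz : z ∈ unitDisk) :
    bigLambda f z = ‖deriv h z‖ + ‖deriv g z‖ := by
  rw [bigLambda, S.dz_eq hz, S.dzbar_eq hz, Complex.norm_conj]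

theorem sub (S : IsHarmonicSplitting f h g) (S₁ : IsHarmonicSplitting f₁ h₁ g₁) :
    IsHarmonicSplitting (f - f₁) (h - h₁) (g - g₁) where
  left := S.left.sub S₁.left
  right := S.right.sub S₁.right
  eqOn z hz := by
    simp only [Pi.sub_apply, S.eqOn hz, S₁.eqOn hz, map_sub]
    ring

theorem swap (S : IsHarmonicSplitting f h g) :
    IsHarmonicSplitting (fun z => conj (f z)) g h where
  left := S.right
  right := S.left
  eqOn z hz := by
    simp only [S.eqOn hz, map_add, Complex.conj_conj]
    ring

theorem compOp (S : IsHarmonicSplitting f h g) {φ : ℂ → ℂ} (hφ : DifferentiableOn ℂ φ unitDisk)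
    (hmaps : MapsTo φ unitDisk unitDisk) :
    IsHarmonicSplitting (compOp φ f) (h ∘ φ) (g ∘ φ) where
  left := S.left.comp hφ hmaps
  right := S.right.comp hφ hmaps
  eqOn _ hz := S.eqOn (hmaps hz)

theorem continuousOn (S : IsHarmonicSplitting f h g) : ContinuousOn f unitDisk :=
  ContinuousOn.congr (S.left.continuousOn.add
    (Complex.continuous_conj.comp_continuousOn S.right.continuousOn)) S.eqOn

theorem diffContOnCl_left (S : IsHarmonicSplitting f h g) {w : ℂ} {ρ : ℝ}
    (hsub : Metric.closedBall w ρ ⊆ unitDisk) : DiffContOnCl ℂ h (Metric.ball w ρ) :=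
  (S.left.mono (Metric.closure_ball_subset_closedBall.trans hsub)).diffContOnCl

theorem circleIntegrable (S : IsHarmonicSplitting f h g) {w : ℂ} {ρ : ℝ} (hρ : 0 ≤ ρ)
    (hsub : Metric.closedBall w ρ ⊆ unitDisk) : CircleIntegrable f w ρ :=
  (S.continuousOn.mono (Metric.sphere_subset_closedBall.trans hsub)).circleIntegrable hρ

/-- Poisson's formula for complex-valued harmonic functions: the kernel is real, so averaging against
it commutes with conjugation and the holomorphic case applies to both parts. -/
theorem circleAverage_poissonKernel_smul (S : IsHarmonicSplitting f h g) {w : ℂ} {R : ℝ}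
    (hw : ‖w‖ < R) (hR : R < 1) :
    Real.circleAverage (fun z => poissonKernel 0 w z • f z) 0 R = f w := by
  have hR0 : 0 < R := (norm_nonneg w).trans_lt hw
  have hwb : w ∈ Metric.ball (0 : ℂ) R := mem_ball_zero_iff.2 hw
  have hsub : Metric.closedBall (0 : ℂ) R ⊆ unitDisk := Metric.closedBall_subset_ball hR
  have hP : ContinuousOn (poissonKernel 0 w) (Metric.sphere 0 R) := by
    rw [poissonKernel_eq_re_herglotzRieszKernel]
    refine Complex.continuous_re.comp_continuousOn ?_
    simpa [abs_of_pos hR0] using continuousOn_herglotzRieszKernel_sphere hwb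
  have hss : Metric.sphere (0 : ℂ) R ⊆ unitDisk := Metric.sphere_subset_closedBall.trans hsub
  have ih : CircleIntegrable (fun z => poissonKernel 0 w z • h z) 0 R :=
    (hP.smul (S.left.continuousOn.mono hss)).circleIntegrable hR0.le
  have ig : CircleIntegrable (fun z => poissonKernel 0 w z • g z) 0 R :=
    (hP.smul (S.right.continuousOn.mono hss)).circleIntegrable hR0.le
  have ig' : CircleIntegrable (fun z => poissonKernel 0 w z • starRingEnd ℂ (g z)) 0 R :=
    (hP.smul (Complex.continuous_conj.comp_continuousOn
      (S.right.continuousOn.mono hss))).circleIntegrable hR0.le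
  have eh := (S.diffContOnCl_left hsub).circleAverage_poissonKernel_smul hwb
  have eg := (S.swap.diffContOnCl_left hsub).circleAverage_poissonKernel_smul hwb
  have e2 := (Complex.conjCLE : ℂ →L[ℝ] ℂ).circleAverage_comp_comm ig
  have e3 : ((Complex.conjCLE : ℂ →L[ℝ] ℂ) ∘ fun z => poissonKernel 0 w z • g z) =
      fun z => poissonKernel 0 w z • starRingEnd ℂ (g z) := by
    ext z
    simp
  rw [e3] at e2
  have e4 : Real.circleAverage (fun z => poissonKernel 0 w z • f z) 0 R =
      Real.circleAverage (fun z => poissonKernel 0 w z • h z +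
        poissonKernel 0 w z • starRingEnd ℂ (g z)) 0 R := by
    refine Real.circleAverage_congr_sphere fun z hz => ?_
    rw [abs_of_pos hR0] at hz
    simp only [S.eqOn (hss hz), smul_add]
  rw [e4, Real.circleAverage_fun_add ih ig', e2, S.eqOn (hsub (Metric.ball_subset_closedBall hwb))]
  congr 1
  exact congrArg (starRingEnd ℂ) eg

/-- Cauchy's formula for `h' w` may be written with `f` in place of `h`: on the circle,
`(z - w)⁻¹ * conj (g z)` is the conjugate of a multiple of `(z - w) * g z`, which vanishes at the
centre. -/
theorem circleAverage_inv_mul (S : IsHarmonicSplitting f h g) {w : ℂ} {ρ : ℝ} (hρ : 0 < ρ)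
    (hsub : Metric.closedBall w ρ ⊆ unitDisk) :
    Real.circleAverage (fun z => (z - w)⁻¹ * f z) w ρ = deriv h w := by
  have hss : Metric.sphere w ρ ⊆ unitDisk := Metric.sphere_subset_closedBall.trans hsub
  have hne : ∀ z ∈ Metric.sphere w ρ, z - w ≠ 0 := fun z hz =>
    sub_ne_zero.2 (Metric.ne_of_mem_sphere hz hρ.ne')
  have hinv : ContinuousOn (fun z => (z - w)⁻¹) (Metric.sphere w ρ) :=
    ContinuousOn.inv₀ (by fun_prop) hne
  have ih : CircleIntegrable (fun z => (z - w)⁻¹ * h z) w ρ :=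
    (hinv.mul (S.left.continuousOn.mono hss)).circleIntegrable hρ.le
  have ig' : CircleIntegrable (fun z => (z - w)⁻¹ * starRingEnd ℂ (g z)) w ρ :=
    (hinv.mul (Complex.continuous_conj.comp_continuousOn
      (S.right.continuousOn.mono hss))).circleIntegrable hρ.le
  have ig : CircleIntegrable (fun z => (z - w) * g z) w ρ :=
    (ContinuousOn.mul (by fun_prop) (S.right.continuousOn.mono hss)).circleIntegrable hρ.le
  have e1 : Real.circleAverage (fun z => (z - w)⁻¹ * h z) w ρ = deriv h w := by
    rw [Real.circleAverage_eq_circleIntegral hρ.ne']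
    have := Complex.two_pi_I_inv_smul_circleIntegral_sub_sq_inv_smul_of_differentiable
      isOpen_unitDisk hsub S.left (Metric.mem_ball_self hρ)
    rw [← this]
    congr 1
    refine circleIntegral.integral_congr hρ.le fun z hz => ?_
    simp only [smul_eq_mul, sq, mul_inv, mul_assoc]
  have e2 : Real.circleAverage (fun z => (z - w) * g z) w ρ = 0 := by
    have hd : DiffContOnCl ℂ (fun z => (z - w) * g z) (Metric.ball w |ρ|) := by
      rw [abs_of_pos hρ]
      exact DiffContOnCl.smul (f := fun z => g z) (c := fun z => z - w)
        ((differentiable_id.sub_const w).diffContOnCl) (S.swap.diffContOnCl_left hsub)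
    rw [hd.circleAverage]
    simp
  have e3 : Real.circleAverage (fun z => (z - w)⁻¹ * starRingEnd ℂ (g z)) w ρ = 0 := by
    have h1 := (Complex.conjCLE : ℂ →L[ℝ] ℂ).circleAverage_comp_comm ig
    rw [e2, map_zero] at h1
    have h2 : Real.circleAverage (fun z => (z - w)⁻¹ * starRingEnd ℂ (g z)) w ρ =
        Real.circleAverage (((ρ ^ 2)⁻¹ : ℝ) •
          ((Complex.conjCLE : ℂ →L[ℝ] ℂ) ∘ fun z => (z - w) * g z)) w ρ := by
      refine Real.circleAverage_congr_sphere fun z hz => ?_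
      rw [abs_of_pos hρ, mem_sphere_iff_norm] at hz
      simp only [Pi.smul_apply, Function.comp_apply, ContinuousLinearEquiv.coe_coe,
        Complex.conjCLE_apply, Complex.real_smul, map_mul]
      rw [Complex.inv_def, Complex.normSq_eq_norm_sq, hz]
      ring
    rw [h2, Real.circleAverage_smul, h1, smul_zero]
  have e4 : Real.circleAverage (fun z => (z - w)⁻¹ * f z) w ρ =
      Real.circleAverage (fun z => (z - w)⁻¹ * h z + (z - w)⁻¹ * starRingEnd ℂ (g z)) w ρ := by
    refine Real.circleAverage_congr_sphere fun z hz => ?_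
    rw [abs_of_pos hρ] at hz
    simp only [S.eqOn (hss hz), mul_add]
  rw [e4, Real.circleAverage_fun_add ih ig', e1, e3, add_zero]

theorem norm_deriv_left_le (S : IsHarmonicSplitting f h g) {w : ℂ} {ρ B : ℝ} (hρ : 0 < ρ)
    (hsub : Metric.closedBall w ρ ⊆ unitDisk) (hB : ∀ z ∈ Metric.sphere w ρ, ‖f z‖ ≤ B) :
    ‖deriv h w‖ ≤ B / ρ := by
  rw [← S.circleAverage_inv_mul hρ hsub, Real.circleAverage_def, norm_smul]
  have h1 : ‖∫ θ in (0 : ℝ)..2 * Real.pi,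
      (circleMap w ρ θ - w)⁻¹ * f (circleMap w ρ θ)‖ ≤ B / ρ * |2 * Real.pi - 0| := by
    refine intervalIntegral.norm_integral_le_of_norm_le_const fun θ _ => ?_
    have := hB _ (circleMap_mem_sphere w hρ.le θ)
    rw [norm_mul, norm_inv, circleMap_sub_center, norm_circleMap_zero, abs_of_pos hρ,
      div_eq_inv_mul]
    gcongr
  have hpi := Real.two_pi_pos
  rw [sub_zero, abs_of_pos hpi] at h1
  rw [norm_inv, Real.norm_of_nonneg hpi.le, inv_mul_le_iff₀ hpi]
  linarith

theorem norm_deriv_right_le (S : IsHarmonicSplitting f h g) {w : ℂ} {ρ B : ℝ} (hρ : 0 < ρ)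
    (hsub : Metric.closedBall w ρ ⊆ unitDisk) (hB : ∀ z ∈ Metric.sphere w ρ, ‖f z‖ ≤ B) :
    ‖deriv g w‖ ≤ B / ρ :=
  S.swap.norm_deriv_left_le hρ hsub fun z hz => (Complex.norm_conj _).trans_le (hB z hz)

end IsHarmonicSplitting

theorem bigLambda_nonneg (f : ℂ → ℂ) (z : ℂ) : 0 ≤ bigLambda f z := by
  unfold bigLambda
  positivity

/-- The chain rule for `Λ`. -/
theorem bigLambda_compOp {f φ : ℂ → ℂ} (hf : IsHarmonicOnDisk f)
    (hφ : DifferentiableOn ℂ φ unitDisk) (hmaps : MapsTo φ unitDisk unitDisk) {z : ℂ}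
    (hz : z ∈ unitDisk) : bigLambda (compOp φ f) z = bigLambda f (φ z) * ‖deriv φ z‖ := by
  obtain ⟨h, g, S, -⟩ := exists_isHarmonicSplitting hf
  have hφz := hφ.differentiableAt (isOpen_unitDisk.mem_nhds hz)
  have hn := isOpen_unitDisk.mem_nhds (hmaps hz)
  rw [(S.compOp hφ hmaps).bigLambda_eq hz, S.bigLambda_eq (hmaps hz),
    deriv_comp z (S.left.differentiableAt hn) hφz, deriv_comp z (S.right.differentiableAt hn) hφz,
    norm_mul, norm_mul, add_mul]

theorem bigLambda_sub_le {f g : ℂ → ℂ} (hf : IsHarmonicOnDisk f) (hg : IsHarmonicOnDisk g) {z : ℂ}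
    (hz : z ∈ unitDisk) : bigLambda (f - g) z ≤ bigLambda f z + bigLambda g z := by
  obtain ⟨h, k, S, -⟩ := exists_isHarmonicSplitting hf
  obtain ⟨h₁, k₁, S₁, -⟩ := exists_isHarmonicSplitting hg
  have hn := isOpen_unitDisk.mem_nhds hz
  rw [(S.sub S₁).bigLambda_eq hz, S.bigLambda_eq hz, S₁.bigLambda_eq hz,
    deriv_sub (S.left.differentiableAt hn) (S₁.left.differentiableAt hn),
    deriv_sub (S.right.differentiableAt hn) (S₁.right.differentiableAt hn)]
  linarith [norm_sub_le (deriv h z) (deriv h₁ z), norm_sub_le (deriv k z) (deriv k₁ z)]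

/-! ### Pointwise estimates in the harmonic Hardy space -/

theorem integralMean_eq {p r : ℝ} (hp : 0 ≤ p) (hr0 : 0 ≤ r) (hr1 : r < 1) {f : ℂ → ℂ}
    (hf : ContinuousOn f unitDisk) :
    integralMean p r f =
      ENNReal.ofReal (Real.circleAverage (fun z => ‖f z‖ ^ p) 0 r) ^ (1 / p) := by
  have hc : Continuous fun θ : ℝ => ‖f (circleMap 0 r θ)‖ ^ p := by
    refine Continuous.rpow_const (Continuous.norm ?_) fun _ => Or.inr hp
    refine hf.comp_continuous (continuous_circleMap 0 r) fun θ => mem_unitDisk.2 ?_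
    rwa [norm_circleMap_zero, abs_of_nonneg hr0]
  have hpi := Real.two_pi_pos
  have hint : IntegrableOn (fun θ : ℝ => ‖f (circleMap 0 r θ)‖ ^ p) (Icc 0 (2 * Real.pi)) :=
    hc.continuousOn.integrableOn_Icc
  rw [integralMean, Real.circleAverage_def, intervalIntegral.integral_of_le hpi.le,
    ← integral_Icc_eq_integral_Ioc, smul_eq_mul, ENNReal.ofReal_mul (by positivity),
    ofReal_integral_eq_lintegral_ofReal hint (Eventually.of_forall fun θ => by positivity), one_div]
  congr 2
  refine lintegral_congr fun θ => ?_
  rw [← ofReal_norm, ENNReal.ofReal_rpow_of_nonneg (norm_nonneg _) hp]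

theorem integralMean_le_iff {p r M : ℝ} (hp : 0 < p) (hr0 : 0 ≤ r) (hr1 : r < 1) (hM : 0 ≤ M)
    {f : ℂ → ℂ} (hf : ContinuousOn f unitDisk) :
    integralMean p r f ≤ ENNReal.ofReal M ↔
      Real.circleAverage (fun z => ‖f z‖ ^ p) 0 r ≤ M ^ p := by
  rw [integralMean_eq hp.le hr0 hr1 hf, one_div, ENNReal.rpow_inv_le_iff hp,
    ENNReal.ofReal_rpow_of_nonneg hM hp.le, ENNReal.ofReal_le_ofReal_iff (by positivity)]

theorem hardyNorm_le_iff {p M : ℝ} (hp : 0 < p) (hM : 0 ≤ M) {f : ℂ → ℂ}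
    (hf : ContinuousOn f unitDisk) :
    hardyNorm p f ≤ ENNReal.ofReal M ↔
      ∀ r ∈ Ioo (0 : ℝ) 1, Real.circleAverage (fun z => ‖f z‖ ^ p) 0 r ≤ M ^ p := by
  rw [hardyNorm, iSup₂_le_iff]
  exact forall₂_congr fun r hr => integralMean_le_iff hp hr.1.le hr.2 hM hf

/-- A form of Young's inequality that replaces Hölder's inequality below: `t` is chosen afterwards. -/
theorem le_rpow_mul_add {p x t : ℝ} (hp : 1 ≤ p) (hx : 0 ≤ x) (ht : 0 < t) :
    x ≤ x ^ p * t ^ (1 - p) + t := by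
  rcases le_total x t with h | h
  · have : 0 ≤ x ^ p * t ^ (1 - p) := by positivity
    linarith
  · have hx0 : 0 < x := ht.trans_le h
    have h1 : x ^ (1 - p) ≤ t ^ (1 - p) := Real.rpow_le_rpow_of_nonpos ht h (by linarith)
    have h2 : x ^ p * x ^ (1 - p) = x := by
      rw [← Real.rpow_add hx0]
      simp
    nlinarith [Real.rpow_nonneg hx p]

theorem isHarmonicSplitting_const (c : ℂ) : IsHarmonicSplitting (fun _ => c) (fun _ => c) 0 where
  left := differentiableOn_const c
  right := differentiableOn_const 0
  eqOn _ _ := by simp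

theorem circleAverage_poissonKernel {w : ℂ} {R : ℝ} (hw : ‖w‖ < R) (hR : R < 1) :
    Real.circleAverage (poissonKernel 0 w) 0 R = 1 := by
  have h0 : 0 < R := (norm_nonneg w).trans_lt hw
  have h := (isHarmonicSplitting_const 1).circleAverage_poissonKernel_smul hw hR
  have hP : ContinuousOn (poissonKernel 0 w) (Metric.sphere 0 R) := by
    rw [poissonKernel_eq_re_herglotzRieszKernel]
    refine Complex.continuous_re.comp_continuousOn ?_
    simpa [abs_of_pos h0] using continuousOn_herglotzRieszKernel_sphere (mem_ball_zero_iff.2 hw)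
  have h2 := Complex.ofRealCLM.circleAverage_comp_comm (hP.circleIntegrable h0.le)
  have h3 : (Complex.ofRealCLM ∘ poissonKernel 0 w) = fun z => poissonKernel 0 w z • (1 : ℂ) := by
    ext z
    simp
  rw [h3, h] at h2
  rw [Complex.ofRealCLM_apply] at h2
  exact_mod_cast h2.symm

theorem norm_le_of_circleAverage_le {p M : ℝ} (hp : 1 ≤ p) (hM : 0 < M) {f : ℂ → ℂ}
    (hf : IsHarmonicOnDisk f)
    (h : ∀ r ∈ Ioo (0 : ℝ) 1, Real.circleAverage (fun z => ‖f z‖ ^ p) 0 r ≤ M ^ p) {w : ℂ}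
    (hw : w ∈ unitDisk) : ‖f w‖ ≤ 2 * (4 / (1 - ‖w‖)) ^ (1 / p) * M := by
  obtain ⟨k, g, S, -⟩ := exists_isHarmonicSplitting hf
  have hw1 : ‖w‖ < 1 := mem_unitDisk.1 hw
  have hw0 := norm_nonneg w
  set R := (1 + ‖w‖) / 2 with hRdef
  have hwR : ‖w‖ < R := by linarith
  have hR1 : R < 1 := by linarith
  have hR0 : 0 < R := by linarith
  set K := 4 / (1 - ‖w‖) with hK
  have hK0 : 0 < K := div_pos (by norm_num) (by linarith)
  set t := K ^ (1 / p) * M with ht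
  have ht0 : 0 < t := by positivity
  have hss : Metric.sphere (0 : ℂ) R ⊆ unitDisk := fun z hz =>
    mem_unitDisk.2 (by rwa [mem_sphere_zero_iff_norm.1 hz])
  have hfc : ContinuousOn f (Metric.sphere 0 R) := S.continuousOn.mono hss
  have hP : ContinuousOn (poissonKernel 0 w) (Metric.sphere 0 R) := by
    rw [poissonKernel_eq_re_herglotzRieszKernel]
    refine Complex.continuous_re.comp_continuousOn ?_
    simpa [abs_of_pos hR0] using continuousOn_herglotzRieszKernel_sphere (mem_ball_zero_iff.2 hwR)
  have hP0 : ∀ z ∈ Metric.sphere (0 : ℂ) R, 0 ≤ poissonKernel 0 w z := fun z hz => by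
    rw [poissonKernel_def]
    have : ‖z‖ = R := mem_sphere_zero_iff_norm.1 hz
    refine div_nonneg ?_ (by positivity)
    rw [sub_zero, sub_zero, this]
    nlinarith
  have hPK : ∀ z ∈ Metric.sphere (0 : ℂ) R, poissonKernel 0 w z ≤ K := fun z hz => by
    have h1 := re_herglotzRieszKernel_le hz (mem_ball_zero_iff.2 hwR)
    rw [poissonKernel_eq_re_herglotzRieszKernel]
    refine h1.trans ?_
    rw [hK, sub_zero, div_le_div_iff₀ (by linarith) (by linarith)]
    nlinarith
  have hfp : ContinuousOn (fun z => ‖f z‖ ^ p) (Metric.sphere 0 R) :=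
    hfc.norm.rpow_const fun _ _ => Or.inr (by linarith)
  -- Poisson's formula and the triangle inequality
  have e1 : ‖f w‖ ≤ Real.circleAverage (fun z => poissonKernel 0 w z * ‖f z‖) 0 R := by
    rw [← S.circleAverage_poissonKernel_smul hwR hR1, Real.circleAverage_def,
      Real.circleAverage_def, norm_smul, Real.norm_of_nonneg (by positivity), smul_eq_mul]
    gcongr
    refine (intervalIntegral.norm_integral_le_integral_norm Real.two_pi_pos.le).trans_eq ?_
    refine intervalIntegral.integral_congr fun θ _ => ?_
    simp only [norm_smul]
    rw [Real.norm_of_nonneg (hP0 _ (circleMap_mem_sphere 0 hR0.le θ))]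
  have i1 : CircleIntegrable (fun z => (K * t ^ (1 - p)) • ‖f z‖ ^ p) 0 R :=
    ContinuousOn.circleIntegrable hR0.le (hfp.const_smul (K * t ^ (1 - p)) :)
  have i2 : CircleIntegrable (fun z => t • poissonKernel 0 w z) 0 R :=
    ContinuousOn.circleIntegrable hR0.le (hP.const_smul t :)
  have e2 : Real.circleAverage (fun z => poissonKernel 0 w z * ‖f z‖) 0 R ≤
      Real.circleAverage
        (fun z => (K * t ^ (1 - p)) • ‖f z‖ ^ p + t • poissonKernel 0 w z) 0 R := by
    refine Real.circleAverage_mono ((hP.mul hfc.norm).circleIntegrable hR0.le)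
      (i1.add i2) fun z hz => ?_
    rw [abs_of_pos hR0] at hz
    have a1 := le_rpow_mul_add hp (norm_nonneg (f z)) ht0
    have a2 := hP0 z hz
    have a3 := hPK z hz
    have a4 : 0 ≤ ‖f z‖ ^ p * t ^ (1 - p) := by positivity
    simp only [smul_eq_mul]
    calc poissonKernel 0 w z * ‖f z‖
        ≤ poissonKernel 0 w z * (‖f z‖ ^ p * t ^ (1 - p) + t) := by gcongr
      _ = poissonKernel 0 w z * (‖f z‖ ^ p * t ^ (1 - p)) + t * poissonKernel 0 w z := by ring
      _ ≤ K * (‖f z‖ ^ p * t ^ (1 - p)) + t * poissonKernel 0 w z := by gcongr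
      _ = K * t ^ (1 - p) * ‖f z‖ ^ p + t * poissonKernel 0 w z := by ring
  rw [Real.circleAverage_fun_add i1 i2, Real.circleAverage_fun_smul, Real.circleAverage_fun_smul,
    show Real.circleAverage (fun z => poissonKernel 0 w z) 0 R = 1 from
      circleAverage_poissonKernel hwR hR1, smul_eq_mul, smul_eq_mul, mul_one] at e2
  have e3 := h R ⟨hR0, hR1⟩
  -- `t` is the value for which the two terms are equal
  have e4 : K * t ^ (1 - p) * M ^ p = t := by
    have hp0 : p ≠ 0 := by linarith
    rw [ht, Real.mul_rpow (by positivity) hM.le, ← Real.rpow_mul hK0.le]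
    have b1 : M ^ (1 - p) * M ^ p = M := by
      rw [← Real.rpow_add hM]
      simp
    have b2 : K * K ^ (1 / p * (1 - p)) = K ^ (1 / p) := by
      nth_rw 1 [← Real.rpow_one K]
      rw [← Real.rpow_add hK0]
      congr 1
      field_simp
      ring
    calc K * (K ^ (1 / p * (1 - p)) * M ^ (1 - p)) * M ^ p
        = K * K ^ (1 / p * (1 - p)) * (M ^ (1 - p) * M ^ p) := by ring
      _ = K ^ (1 / p) * M := by rw [b1, b2]
  have e5 : K * t ^ (1 - p) * Real.circleAverage (fun z => ‖f z‖ ^ p) 0 R ≤ t := by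
    refine le_trans ?_ e4.le
    gcongr
  calc ‖f w‖ ≤ t + t := by linarith
    _ = 2 * K ^ (1 / p) * M := by rw [ht]; ring

/-- Functions in the harmonic Hardy space grow at most like `(1 - |w|)^(-1/p)`. -/
theorem norm_le_of_hardyNorm_le {p M : ℝ} (hp : 1 ≤ p) (hM : 0 ≤ M) {f : ℂ → ℂ}
    (hf : IsHarmonicOnDisk f) (h : hardyNorm p f ≤ ENNReal.ofReal M) {w : ℂ}
    (hw : w ∈ unitDisk) : ‖f w‖ ≤ 2 * (4 / (1 - ‖w‖)) ^ (1 / p) * M := by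
  have ht : Tendsto (fun x => 2 * (4 / (1 - ‖w‖)) ^ (1 / p) * x) (𝓝[>] M)
      (𝓝 (2 * (4 / (1 - ‖w‖)) ^ (1 / p) * M)) :=
    ((continuous_const.mul continuous_id).tendsto M).mono_left nhdsWithin_le_nhds
  refine ge_of_tendsto ht (eventually_mem_nhdsWithin.mono fun M' hM' => ?_)
  have hM'0 : 0 < M' := hM.trans_lt hM'
  exact norm_le_of_circleAverage_le hp hM'0 hf ((hardyNorm_le_iff (by linarith) hM'0.le
    (InnerProductSpace.HarmonicOnNhd.continuousOn hf)).1
      (h.trans (ENNReal.ofReal_le_ofReal (le_of_lt hM')))) hw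

/-- The gradient of a function in the harmonic Hardy space grows at most like
`(1 - |w|²)^(-1-1/p)`: Cauchy's estimate on the circle about `w` of radius `(1 - |w|) / 2`. -/
theorem bigLambda_le_of_hardyNorm_le {p M : ℝ} (hp : 1 ≤ p) (hM : 0 ≤ M) {f : ℂ → ℂ}
    (hf : IsHarmonicOnDisk f) (h : hardyNorm p f ≤ ENNReal.ofReal M) {w : ℂ}
    (hw : w ∈ unitDisk) : bigLambda f w ≤ 256 * M / (1 - ‖w‖ ^ 2) ^ (1 + 1 / p) := by
  obtain ⟨k, g, S, -⟩ := exists_isHarmonicSplitting hf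
  have hw1 : ‖w‖ < 1 := mem_unitDisk.1 hw
  set ρ := (1 - ‖w‖) / 2 with hρ
  have hρ0 : 0 < ρ := by linarith
  have hsub : Metric.closedBall w ρ ⊆ unitDisk := fun z hz => by
    have h1 : ‖z - w‖ ≤ ρ := mem_closedBall_iff_norm.1 hz
    have h2 := norm_sub_norm_le z w
    exact mem_unitDisk.2 (by linarith)
  set x := 1 - ‖w‖ ^ 2 with hx
  have hx0 : 0 < x := one_sub_norm_sq_pos hw
  have hxρ : x / 4 ≤ ρ := by
    have := one_sub_norm_sq_le hw
    linarith
  have hp0 : 0 < 1 / p := by positivity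
  have hB : ∀ z ∈ Metric.sphere w ρ, ‖f z‖ ≤ 32 * M / x ^ (1 / p) := fun z hz => by
    have h1 : ‖z - w‖ ≤ ρ := (mem_sphere_iff_norm.1 hz).le
    have h2 := norm_sub_norm_le z w
    have h3 : x / 4 ≤ 1 - ‖z‖ := by linarith
    have h4 : 4 / (1 - ‖z‖) ≤ 16 / x := by
      rw [div_le_div_iff₀ (by linarith) hx0]
      linarith
    have h5 : (16 : ℝ) ^ (1 / p) ≤ 16 := by
      have : (16 : ℝ) ^ (1 / p) ≤ 16 ^ (1 : ℝ) :=
        Real.rpow_le_rpow_of_exponent_le (by norm_num) (by rw [div_le_one] <;> linarith)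
      simpa using this
    calc ‖f z‖ ≤ 2 * (4 / (1 - ‖z‖)) ^ (1 / p) * M :=
          norm_le_of_hardyNorm_le hp hM hf h (hsub (Metric.sphere_subset_closedBall hz))
      _ ≤ 2 * (16 / x) ^ (1 / p) * M := by
          gcongr
          exact div_nonneg (by norm_num) (by linarith)
      _ = 2 * (16 ^ (1 / p) / x ^ (1 / p)) * M := by rw [Real.div_rpow (by norm_num) hx0.le]
      _ ≤ 2 * (16 / x ^ (1 / p)) * M := by gcongr
      _ = 32 * M / x ^ (1 / p) := by ring
  have h1 := S.norm_deriv_left_le hρ0 hsub hB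
  have h2 := S.norm_deriv_right_le hρ0 hsub hB
  rw [S.bigLambda_eq hw, Real.rpow_add hx0, Real.rpow_one]
  have h3 : 32 * M / x ^ (1 / p) / ρ ≤ 32 * M / x ^ (1 / p) / (x / 4) := by gcongr
  calc _ ≤ 32 * M / x ^ (1 / p) / (x / 4) + 32 * M / x ^ (1 / p) / (x / 4) := by linarith
    _ = 256 * M / (x * x ^ (1 / p)) := by
      field_simp
      ring

/-! ### Test functions -/

/-- The function `((1 - |a|²) / (1 - ā z)²)^(1/p)`: the holomorphic function with `|f|^p` equal to
the Poisson kernel at `a` on the unit circle. The principal branch of the power is used, which is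
holomorphic where `1 - ā z` has positive real part. -/
noncomputable def hardyTestFun (p : ℝ) (a z : ℂ) : ℂ :=
  ((1 - ‖a‖ ^ 2) ^ (1 / p) : ℝ) * (1 - conj a * z) ^ ((-(2 / p) : ℝ) : ℂ)

theorem one_sub_conj_mul_re_pos {a z : ℂ} (ha : ‖a‖ < 1) (hz : ‖z‖ < 1) :
    0 < (1 - conj a * z).re := by
  have h1 : (conj a * z).re ≤ ‖a‖ * ‖z‖ := by
    simpa using Complex.re_le_norm (conj a * z)
  have h2 : ‖a‖ * ‖z‖ < 1 := by nlinarith [norm_nonneg a, norm_nonneg z]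
  simp only [Complex.sub_re, Complex.one_re]
  linarith

theorem one_sub_norm_le_norm_one_sub_conj_mul {a z : ℂ} (ha : ‖a‖ ≤ 1) :
    1 - ‖z‖ ≤ ‖1 - conj a * z‖ := by
  have h1 := norm_sub_norm_le (1 : ℂ) (conj a * z)
  rw [norm_one, norm_mul, Complex.norm_conj] at h1
  nlinarith [norm_nonneg z]

theorem norm_cpow_ofReal_of_re_pos {w : ℂ} (hw : 0 < w.re) (s : ℝ) :
    ‖w ^ (s : ℂ)‖ = ‖w‖ ^ s := by
  have : w ≠ 0 := fun h => by simp [h] at hw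
  rw [Complex.norm_cpow_of_ne_zero this]
  simp

theorem hasDerivAt_hardyTestFun (p : ℝ) {a z : ℂ} (ha : ‖a‖ < 1) (hz : ‖z‖ < 1) :
    HasDerivAt (hardyTestFun p a) (((1 - ‖a‖ ^ 2) ^ (1 / p) : ℝ) *
      (((-(2 / p) : ℝ) : ℂ) * (1 - conj a * z) ^ ((-(2 / p) - 1 : ℝ) : ℂ) * (-conj a))) z := by
  have h1 : HasDerivAt (fun z => 1 - conj a * z) (-conj a) z := by
    simpa using ((hasDerivAt_id z).const_mul (conj a)).const_sub 1
  have h2 := h1.cpow_const (c := ((-(2 / p) : ℝ) : ℂ)) (Or.inl (one_sub_conj_mul_re_pos ha hz))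
  have h3 : ((-(2 / p) - 1 : ℝ) : ℂ) = ((-(2 / p) : ℝ) : ℂ) - 1 := by push_cast; ring
  rw [h3]
  exact h2.const_mul _

theorem norm_deriv_hardyTestFun {p : ℝ} (hp : 0 < p) {a z : ℂ} (ha : ‖a‖ < 1) (hz : ‖z‖ < 1) :
    ‖deriv (hardyTestFun p a) z‖ =
      (1 - ‖a‖ ^ 2) ^ (1 / p) * (2 / p * ‖1 - conj a * z‖ ^ (-(2 / p) - 1) * ‖a‖) := by
  have h0 := one_sub_norm_sq_pos (mem_unitDisk.2 ha)
  rw [(hasDerivAt_hardyTestFun p ha hz).deriv, norm_mul, norm_mul, norm_mul,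
    norm_cpow_ofReal_of_re_pos (one_sub_conj_mul_re_pos ha hz), norm_neg, Complex.norm_conj,
    Complex.norm_real, Complex.norm_real, norm_neg, Real.norm_of_nonneg (by positivity),
    Real.norm_of_nonneg (by positivity)]

theorem isHarmonicSplitting_hardyTestFun (p : ℝ) {a : ℂ} (ha : ‖a‖ < 1) :
    IsHarmonicSplitting (hardyTestFun p a) (hardyTestFun p a) 0 where
  left _ hz := (hasDerivAt_hardyTestFun p ha
    (mem_unitDisk.1 hz)).differentiableAt.differentiableWithinAt
  right := differentiableOn_const 0
  eqOn _ _ := by simp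

theorem bigLambda_hardyTestFun {p : ℝ} (hp : 0 < p) {a z : ℂ} (ha : ‖a‖ < 1) (hz : ‖z‖ < 1) :
    bigLambda (hardyTestFun p a) z =
      (1 - ‖a‖ ^ 2) ^ (1 / p) * (2 / p * ‖1 - conj a * z‖ ^ (-(2 / p) - 1) * ‖a‖) := by
  rw [(isHarmonicSplitting_hardyTestFun p ha).bigLambda_eq (mem_unitDisk.2 hz),
    norm_deriv_hardyTestFun hp ha hz]
  simp

/-- At its own pole the test function attains the order of growth `(1 - |a|²)^(-1-1/p)` of the
gradient that the Hardy space allows. -/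
theorem bigLambda_hardyTestFun_self {p : ℝ} (hp : 0 < p) {a : ℂ} (ha : ‖a‖ < 1) :
    bigLambda (hardyTestFun p a) a = 2 / p * ‖a‖ / (1 - ‖a‖ ^ 2) ^ (1 + 1 / p) := by
  have h0 := one_sub_norm_sq_pos (mem_unitDisk.2 ha)
  have h1 : ‖1 - conj a * a‖ = 1 - ‖a‖ ^ 2 := by
    rw [Complex.conj_mul', ← Complex.ofReal_pow, ← Complex.ofReal_one, ← Complex.ofReal_sub,
      Complex.norm_real, Real.norm_of_nonneg h0.le]
  rw [bigLambda_hardyTestFun hp ha ha, h1, eq_div_iff (by positivity)]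
  have h2 : (1 - ‖a‖ ^ 2) ^ (1 / p) * (1 - ‖a‖ ^ 2) ^ (-(2 / p) - 1) *
      (1 - ‖a‖ ^ 2) ^ (1 + 1 / p) = 1 := by
    rw [← Real.rpow_add h0, ← Real.rpow_add h0]
    convert Real.rpow_zero _ using 2
    ring
  linear_combination 2 / p * ‖a‖ * h2

/-- Since `|z - a r²| = r |1 - ā z|` for `|z| = r`, the mean is a multiple of the mean of the Poisson
kernel at `a r²`. -/
theorem circleAverage_one_sub_conj_mul {a : ℂ} (ha : ‖a‖ < 1) {r : ℝ} (hr : r ∈ Ioo (0 : ℝ) 1) :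
    Real.circleAverage (fun z => (‖1 - conj a * z‖ ^ 2)⁻¹) 0 r = (1 - ‖a‖ ^ 2 * r ^ 2)⁻¹ := by
  obtain ⟨hr0, hr1⟩ := hr
  have ha0 := norm_nonneg a
  have hw : ‖a * (r : ℂ) ^ 2‖ < r := by
    rw [norm_mul, norm_pow, Complex.norm_real, Real.norm_of_nonneg hr0.le]
    nlinarith [mul_pos hr0 hr0]
  have h1 := circleAverage_poissonKernel hw hr1
  have hpos : 0 < 1 - ‖a‖ ^ 2 * r ^ 2 := by
    have : (‖a‖ * r) < 1 := by nlinarith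
    nlinarith [mul_nonneg ha0 hr0.le]
  have h2 : Real.circleAverage (fun z => (‖1 - conj a * z‖ ^ 2)⁻¹) 0 r =
      Real.circleAverage
        (fun z => (1 - ‖a‖ ^ 2 * r ^ 2)⁻¹ • poissonKernel 0 (a * (r : ℂ) ^ 2) z) 0 r := by
    refine Real.circleAverage_congr_sphere fun z hz => ?_
    rw [abs_of_pos hr0, mem_sphere_zero_iff_norm] at hz
    have e1 : z - a * (r : ℂ) ^ 2 = z * conj (1 - conj a * z) := by
      have : (r : ℂ) ^ 2 = z * conj z := by rw [Complex.mul_conj', hz]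
      rw [this]
      simp only [map_sub, map_one, map_mul, Complex.conj_conj]
      ring
    simp only [poissonKernel_def, sub_zero, smul_eq_mul]
    rw [e1, norm_mul, norm_mul, Complex.norm_conj, norm_pow, Complex.norm_real,
      Real.norm_of_nonneg hr0.le, hz]
    rcases eq_or_ne ‖1 - conj a * z‖ 0 with h0 | h0
    · simp [h0]
    · field_simp
  rw [h2, Real.circleAverage_fun_smul, h1, smul_eq_mul, mul_one]

theorem hardyNorm_hardyTestFun_le {p : ℝ} (hp : 0 < p) {a : ℂ} (ha : ‖a‖ < 1) :
    hardyNorm p (hardyTestFun p a) ≤ ENNReal.ofReal 1 := by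
  have h0 := one_sub_norm_sq_pos (mem_unitDisk.2 ha)
  rw [hardyNorm_le_iff hp zero_le_one (isHarmonicSplitting_hardyTestFun p ha).continuousOn]
  intro r hr
  have h1 : Real.circleAverage (fun z => ‖hardyTestFun p a z‖ ^ p) 0 r =
      Real.circleAverage (fun z => (1 - ‖a‖ ^ 2) • (‖1 - conj a * z‖ ^ 2)⁻¹) 0 r := by
    refine Real.circleAverage_congr_sphere fun z hz => ?_
    rw [abs_of_pos hr.1, mem_sphere_zero_iff_norm] at hz
    have hre := one_sub_conj_mul_re_pos ha (hz.trans_lt hr.2)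
    have hn : 0 ≤ ‖1 - conj a * z‖ := norm_nonneg _
    simp only [hardyTestFun, smul_eq_mul]
    rw [norm_mul, Complex.norm_real, Real.norm_of_nonneg (by positivity),
      norm_cpow_ofReal_of_re_pos hre, Real.mul_rpow (by positivity) (by positivity),
      ← Real.rpow_mul h0.le, ← Real.rpow_mul hn, one_div_mul_cancel hp.ne', Real.rpow_one,
      show -(2 / p) * p = -2 by field_simp, Real.rpow_neg hn, Real.rpow_two]
  rw [h1, Real.circleAverage_fun_smul, circleAverage_one_sub_conj_mul ha hr, smul_eq_mul,
    Real.one_rpow, ← div_eq_mul_inv]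
  have h2 : 1 - ‖a‖ ^ 2 ≤ 1 - ‖a‖ ^ 2 * r ^ 2 := by
    have : r ^ 2 ≤ 1 := pow_le_one₀ hr.1.le hr.2.le
    nlinarith [sq_nonneg ‖a‖]
  exact (div_le_one (h0.trans_le h2)).2 h2

theorem hardyTestFun_mem {p : ℝ} (hp : 0 < p) {a : ℂ} (ha : ‖a‖ < 1) :
    hardyTestFun p a ∈ harmonicHardy p :=
  ⟨(isHarmonicSplitting_hardyTestFun p ha).isHarmonicOnDisk,
    (hardyNorm_hardyTestFun_le hp ha).trans_lt ENNReal.ofReal_lt_top⟩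

/-- As the poles tend to the boundary, the gradients of the test functions tend to `0` pointwise. -/
theorem tendsto_bigLambda_hardyTestFun {p : ℝ} (hp : 0 < p) {a : ℕ → ℂ} (ha : ∀ n, ‖a n‖ < 1)
    (hlim : Tendsto (fun n => ‖a n‖) atTop (𝓝 1)) {z : ℂ} (hz : ‖z‖ < 1) :
    Tendsto (fun n => bigLambda (hardyTestFun p (a n)) z) atTop (𝓝 0) := by
  have h1 : Tendsto (fun n => (1 - ‖a n‖ ^ 2) ^ (1 / p) * (2 / p * (1 - ‖z‖) ^ (-(2 / p) - 1)))
      atTop (𝓝 ((1 - 1 ^ 2) ^ (1 / p) * (2 / p * (1 - ‖z‖) ^ (-(2 / p) - 1)))) :=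
    ((((hlim.pow 2).const_sub 1).rpow_const (Or.inr (by positivity))).mul_const _)
  have h2 : ((1 : ℝ) - 1 ^ 2) ^ (1 / p) = 0 := by
    rw [one_pow, sub_self, Real.zero_rpow (by positivity)]
  rw [h2, zero_mul] at h1
  refine squeeze_zero (fun n => bigLambda_nonneg _ _) (fun n => ?_) h1
  rw [bigLambda_hardyTestFun hp (ha n) hz]
  have h0 := one_sub_norm_sq_pos (mem_unitDisk.2 (ha n))
  have hz0 : 0 < 1 - ‖z‖ := by linarith
  have h3 : ‖1 - conj (a n) * z‖ ^ (-(2 / p) - 1) ≤ (1 - ‖z‖) ^ (-(2 / p) - 1) := by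
    refine Real.rpow_le_rpow_of_nonpos hz0 (one_sub_norm_le_norm_one_sub_conj_mul (ha n).le) ?_
    have : 0 < 2 / p := by positivity
    linarith
  refine mul_le_mul_of_nonneg_left ?_ (by positivity)
  calc 2 / p * ‖1 - conj (a n) * z‖ ^ (-(2 / p) - 1) * ‖a n‖
      ≤ 2 / p * (1 - ‖z‖) ^ (-(2 / p) - 1) * 1 := by
        gcongr
        exact (ha n).le
    _ = _ := mul_one _

/-! ### Normal families -/

/-- Montel's theorem on the unit disk. A diagonal subsequence along which every Taylor coefficient at
`0` converges does it; Cauchy's estimates on a slightly larger circle dominate the Taylor series, so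
the limit may be taken term by term. -/
theorem exists_subseq_tendstoLocallyUniformlyOn {h : ℕ → ℂ → ℂ}
    (hd : ∀ n, DifferentiableOn ℂ (h n) unitDisk)
    (hb : ∀ s ∈ Ioo (0 : ℝ) 1, ∃ B : ℝ, ∀ n, ∀ z ∈ Metric.sphere (0 : ℂ) s, ‖h n z‖ ≤ B) :
    ∃ H : ℂ → ℂ, ∃ σ : ℕ → ℕ, StrictMono σ ∧
      TendstoLocallyUniformlyOn (fun n => h (σ n)) H atTop unitDisk := by
  choose! B hB using hb
  set c : ℕ → ℕ → ℂ := fun n k => (k.factorial : ℂ)⁻¹ * iteratedDeriv k (h n) 0 with hc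
  have hcb : ∀ s ∈ Ioo (0 : ℝ) 1, ∀ n k, ‖c n k‖ ≤ B s / s ^ k := fun s hs n k => by
    have hdc : DiffContOnCl ℂ (h n) (Metric.ball 0 s) :=
      ((hd n).mono (Metric.closure_ball_subset_closedBall.trans
        (Metric.closedBall_subset_ball hs.2))).diffContOnCl
    have h1 := Complex.norm_iteratedDeriv_le_of_forall_mem_sphere_norm_le k hs.1 hdc (hB s hs n)
    have hk : (0 : ℝ) < k.factorial := by positivity
    rw [hc, norm_mul, norm_inv, Complex.norm_natCast, inv_mul_le_iff₀ hk, ← mul_div_assoc]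
    exact h1
  have hhalf : (1 / 2 : ℝ) ∈ Ioo (0 : ℝ) 1 := by constructor <;> norm_num
  have hcpt : IsCompact (Set.pi univ fun k => Metric.closedBall (0 : ℂ) (B (1 / 2) / (1 / 2) ^ k)) :=
    isCompact_univ_pi fun k => isCompact_closedBall _ _
  obtain ⟨C, -, σ, hσ, hlim⟩ := hcpt.tendsto_subseq (x := c)
    fun n k _ => mem_closedBall_zero_iff.2 (hcb _ hhalf n k)
  have hlim' : ∀ k, Tendsto (fun n => c (σ n) k) atTop (𝓝 (C k)) := tendsto_pi_nhds.1 hlim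
  have hCb : ∀ s ∈ Ioo (0 : ℝ) 1, ∀ k, ‖C k‖ ≤ B s / s ^ k := fun s hs k =>
    le_of_tendsto (hlim' k).norm (Eventually.of_forall fun n => hcb s hs (σ n) k)
  refine ⟨fun z => ∑' k, C k * z ^ k, σ, hσ, ?_⟩
  rw [tendstoLocallyUniformlyOn_iff_forall_isCompact isOpen_unitDisk]
  intro K hK hKc
  -- a compact subset of the disk lies in a smaller closed disk, of radius `r < s < 1`
  obtain ⟨r, hr, hKr⟩ : ∃ r ∈ Ioo (0 : ℝ) 1, ∀ z ∈ K, ‖z‖ ≤ r := by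
    rcases K.eq_empty_or_nonempty with rfl | hne
    · exact ⟨1 / 2, hhalf, by simp⟩
    · obtain ⟨x, hx, hmax⟩ := hKc.exists_isMaxOn hne continuous_norm.continuousOn
      have hx1 := mem_unitDisk.1 (hK hx)
      refine ⟨(1 + ‖x‖) / 2, ⟨by positivity, by linarith⟩, fun z hz => ?_⟩
      have : ‖z‖ ≤ ‖x‖ := hmax hz
      linarith
  obtain ⟨s, hrs, hs1⟩ := exists_between hr.2
  have hs : s ∈ Ioo (0 : ℝ) 1 := ⟨hr.1.trans hrs, hs1⟩
  have hs0 := hs.1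
  have hB0 : 0 ≤ B s := by simpa using (norm_nonneg _).trans (hcb s hs 0 0)
  have hq0 : 0 ≤ r / s := div_nonneg hr.1.le hs0.le
  have hq1 : r / s < 1 := (div_lt_one hs0).2 hrs
  have hgeom : Summable fun k : ℕ => 2 * B s * (r / s) ^ k :=
    (summable_geometric_of_lt_one hq0 hq1).mul_left _
  have hterm : ∀ n k, ‖C k - c (σ n) k‖ * r ^ k ≤ 2 * B s * (r / s) ^ k := fun n k => by
    have h1 := (norm_sub_le (C k) (c (σ n) k)).trans (add_le_add (hCb s hs k) (hcb s hs (σ n) k))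
    have hrk : 0 ≤ r ^ k := pow_nonneg hr.1.le k
    calc ‖C k - c (σ n) k‖ * r ^ k ≤ (B s / s ^ k + B s / s ^ k) * r ^ k := by gcongr
      _ = 2 * B s * (r / s) ^ k := by rw [div_pow]; ring
  have htend : Tendsto (fun n => ∑' k, ‖C k - c (σ n) k‖ * r ^ k) atTop (𝓝 0) := by
    have h1 := tendsto_tsum_of_dominated_convergence (𝓕 := atTop)
      (f := fun n k => ‖C k - c (σ n) k‖ * r ^ k) (g := fun _ => (0 : ℝ)) hgeom
      (fun k => by
        have h2 := (((hlim' k).const_sub (C k)).norm).mul_const (r ^ k)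
        simpa using h2)
      (Eventually.of_forall fun n k => by
        rw [Real.norm_of_nonneg (mul_nonneg (norm_nonneg _) (pow_nonneg hr.1.le k))]
        exact hterm n k)
    simpa using h1
  rw [Metric.tendstoUniformlyOn_iff]
  intro ε hε
  filter_upwards [htend.eventually_lt_const hε] with n hn z hz
  have hzr := hKr z hz
  have hzk : ∀ k, ‖z ^ k‖ ≤ r ^ k := fun k => by
    rw [norm_pow]
    exact pow_le_pow_left₀ (norm_nonneg z) hzr k
  have hsumC : Summable fun k => C k * z ^ k := by
    refine Summable.of_norm_bounded (g := fun k => B s * (r / s) ^ k)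
      ((summable_geometric_of_lt_one hq0 hq1).mul_left _) fun k => ?_
    rw [norm_mul]
    calc ‖C k‖ * ‖z ^ k‖ ≤ B s / s ^ k * r ^ k := by
          gcongr
          exacts [hCb s hs k, hzk k]
      _ = B s * (r / s) ^ k := by rw [div_pow]; ring
  have htay : HasSum (fun k => c (σ n) k * z ^ k) (h (σ n) z) := by
    have h1 := Complex.hasSum_taylorSeries_on_ball (c := 0) (r := 1) (hd (σ n)) (hK hz)
    convert! h1 using 2 with k
    simp [hc]
    ring
  have hsum : Summable fun k => ‖C k - c (σ n) k‖ * r ^ k :=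
    hgeom.of_nonneg_of_le (fun k => mul_nonneg (norm_nonneg _) (pow_nonneg hr.1.le k)) (hterm n)
  rw [dist_eq_norm, ← htay.tsum_eq, ← hsumC.tsum_sub htay.summable]
  refine lt_of_le_of_lt (tsum_of_norm_bounded hsum.hasSum fun k => ?_) hn
  rw [← sub_mul, norm_mul]
  exact mul_le_mul_of_nonneg_left (hzk k) (norm_nonneg _)

/-- A bounded sequence in the harmonic Hardy space has a subsequence along which the functions
converge pointwise and `Λ` of the differences tends to `0` locally uniformly, to a limit that
satisfies the same bound. -/
theorem exists_subseq_of_hardyNorm_le {p M : ℝ} (hp : 1 ≤ p) (hM : 0 ≤ M) {u : ℕ → ℂ → ℂ}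
    (hu : ∀ n, IsHarmonicOnDisk (u n)) (hb : ∀ n, hardyNorm p (u n) ≤ ENNReal.ofReal M) :
    ∃ f : ℂ → ℂ, IsHarmonicOnDisk f ∧ hardyNorm p f ≤ ENNReal.ofReal M ∧
      ∃ σ : ℕ → ℕ, StrictMono σ ∧
        (∀ z ∈ unitDisk, Tendsto (fun n => u (σ n) z) atTop (𝓝 (f z))) ∧
        ∀ r : ℝ, r < 1 → ∀ ε : ℝ, 0 < ε →
          ∀ᶠ n in atTop, ∀ z : ℂ, ‖z‖ ≤ r → bigLambda (u (σ n) - f) z < ε := by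
  choose h g S hg0 using fun n => exists_isHarmonicSplitting (hu n)
  have hderiv : ∀ n, ∀ w ∈ unitDisk, ‖deriv (h n) w‖ + ‖deriv (g n) w‖ ≤
      256 * M / (1 - ‖w‖ ^ 2) ^ (1 + 1 / p) := fun n w hw => by
    rw [← (S n).bigLambda_eq hw]
    exact bigLambda_le_of_hardyNorm_le hp hM (hu n) (hb n) hw
  -- integrating the bound on the derivative along radii
  have hloc : ∀ s ∈ Ioo (0 : ℝ) 1, ∃ D : ℝ, ∀ k : ℂ → ℂ, DifferentiableOn ℂ k unitDisk →
      (∀ w ∈ unitDisk, ‖deriv k w‖ ≤ 256 * M / (1 - ‖w‖ ^ 2) ^ (1 + 1 / p)) →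
      ∀ z ∈ Metric.sphere (0 : ℂ) s, ‖k z - k 0‖ ≤ D := fun s hs => by
    refine ⟨256 * M / (1 - s ^ 2) ^ (1 + 1 / p) * s, fun k hk hkd z hz => ?_⟩
    have hzs : ‖z‖ = s := mem_sphere_zero_iff_norm.1 hz
    have hs2 : 0 < 1 - s ^ 2 := by nlinarith [hs.1, hs.2]
    have h1 := (convex_closedBall (0 : ℂ) s).norm_image_sub_le_of_norm_deriv_le (f := k)
      (C := 256 * M / (1 - s ^ 2) ^ (1 + 1 / p)) (x := 0) (y := z)
      (fun x hx => hk.differentiableAt (isOpen_unitDisk.mem_nhds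
        (Metric.closedBall_subset_ball hs.2 hx)))
      (fun x hx => by
        refine (hkd x (Metric.closedBall_subset_ball hs.2 hx)).trans ?_
        have hxs : ‖x‖ ≤ s := mem_closedBall_zero_iff.1 hx
        gcongr)
      (Metric.mem_closedBall_self hs.1.le) (Metric.sphere_subset_closedBall hz)
    rwa [sub_zero, hzs] at h1
  have hhb : ∀ s ∈ Ioo (0 : ℝ) 1, ∃ B : ℝ, ∀ n, ∀ z ∈ Metric.sphere (0 : ℂ) s, ‖h n z‖ ≤ B := by
    intro s hs
    obtain ⟨D, hD⟩ := hloc s hs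
    refine ⟨D + 2 * (4 / (1 - ‖(0 : ℂ)‖)) ^ (1 / p) * M, fun n z hz => ?_⟩
    have h0 : (0 : ℂ) ∈ unitDisk := mem_unitDisk.2 (by simp)
    have h1 : ‖h n z - h n 0‖ ≤ D := hD (h n) (S n).left
      (fun w hw => (le_add_of_nonneg_right (norm_nonneg _)).trans (hderiv n w hw)) z hz
    have h2 := norm_le_of_hardyNorm_le hp hM (hu n) (hb n) h0
    have h3 : u n 0 = h n 0 := by simp [(S n).eqOn h0, hg0]
    rw [h3] at h2
    have h4 := norm_sub_norm_le (h n z) (h n 0)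
    linarith
  obtain ⟨H, σ₁, hσ₁, hH⟩ := exists_subseq_tendstoLocallyUniformlyOn (fun n => (S n).left) hhb
  have hgb : ∀ s ∈ Ioo (0 : ℝ) 1, ∃ B : ℝ, ∀ n, ∀ z ∈ Metric.sphere (0 : ℂ) s,
      ‖g (σ₁ n) z‖ ≤ B := by
    intro s hs
    obtain ⟨D, hD⟩ := hloc s hs
    refine ⟨D, fun n z hz => ?_⟩
    have h1 := hD (g (σ₁ n)) (S (σ₁ n)).right
      (fun w hw => (le_add_of_nonneg_left (norm_nonneg _)).trans (hderiv (σ₁ n) w hw)) z hz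
    rwa [hg0, sub_zero] at h1
  obtain ⟨G, σ₂, hσ₂, hG⟩ :=
    exists_subseq_tendstoLocallyUniformlyOn (fun n => (S (σ₁ n)).right) hgb
  have hH' : TendstoLocallyUniformlyOn (fun n => h (σ₁ (σ₂ n))) H atTop unitDisk :=
    fun v hv x hx => by
      obtain ⟨t, ht, htv⟩ := hH v hv x hx
      exact ⟨t, ht, hσ₂.tendsto_atTop.eventually htv⟩
  have hhd : ∀ᶠ n in atTop, DifferentiableOn ℂ (h (σ₁ (σ₂ n))) unitDisk :=
    Eventually.of_forall fun n => (S _).left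
  have hgd : ∀ᶠ n in atTop, DifferentiableOn ℂ (g (σ₁ (σ₂ n))) unitDisk :=
    Eventually.of_forall fun n => (S _).right
  have T : IsHarmonicSplitting (fun z => H z + conj (G z)) H G :=
    ⟨hH'.differentiableOn hhd isOpen_unitDisk, hG.differentiableOn hgd isOpen_unitDisk,
      fun _ _ => rfl⟩
  have hpt : ∀ z ∈ unitDisk,
      Tendsto (fun n => u (σ₁ (σ₂ n)) z) atTop (𝓝 (H z + conj (G z))) := fun z hz => by
    have h1 := (hH'.tendsto_at hz).add
      ((Complex.continuous_conj.tendsto _).comp (hG.tendsto_at hz))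
    exact h1.congr fun n => ((S _).eqOn hz).symm
  refine ⟨_, T.isHarmonicOnDisk, ?_, σ₁ ∘ σ₂, hσ₁.comp hσ₂, hpt, fun r hr ε hε => ?_⟩
  · -- Fatou's lemma on each circle
    have hp0 : 0 < p := by linarith
    rw [hardyNorm, iSup₂_le_iff]
    intro r hr
    have hmem : ∀ θ : ℝ, circleMap 0 r θ ∈ unitDisk := fun θ => mem_unitDisk.2 (by
      rw [norm_circleMap_zero, abs_of_pos hr.1]
      exact hr.2)
    have hint : ∀ n, ENNReal.ofReal (1 / (2 * Real.pi)) *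
        ∫⁻ θ in Icc 0 (2 * Real.pi), ‖u (σ₁ (σ₂ n)) (circleMap 0 r θ)‖ₑ ^ p ≤
          ENNReal.ofReal M ^ p := fun n => by
      have h1 : integralMean p r (u (σ₁ (σ₂ n))) ≤ ENNReal.ofReal M :=
        le_trans (le_iSup₂ (f := fun r (_ : r ∈ Ioo (0 : ℝ) 1) =>
          integralMean p r (u (σ₁ (σ₂ n)))) r hr) (hb _)
      rwa [integralMean, one_div p, ENNReal.rpow_inv_le_iff hp0] at h1
    rw [integralMean, one_div p, ENNReal.rpow_inv_le_iff hp0]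
    have hfatou : ∫⁻ θ in Icc 0 (2 * Real.pi),
          ‖H (circleMap 0 r θ) + conj (G (circleMap 0 r θ))‖ₑ ^ p ≤
        liminf (fun n => ∫⁻ θ in Icc 0 (2 * Real.pi),
          ‖u (σ₁ (σ₂ n)) (circleMap 0 r θ)‖ₑ ^ p) atTop := by
      refine le_trans (lintegral_mono fun θ => ?_) (lintegral_liminf_le fun n => ?_)
      · have h1 := ((ENNReal.continuous_rpow_const (y := p)).tendsto _).comp
          (hpt _ (hmem θ)).enorm
        exact h1.liminf_eq.ge
      · have hcont : Continuous fun θ : ℝ => u (σ₁ (σ₂ n)) (circleMap 0 r θ) :=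
          (S _).continuousOn.comp_continuous (continuous_circleMap 0 r) hmem
        exact ((ENNReal.continuous_rpow_const (y := p)).comp hcont.enorm).measurable
    have hc0 : ENNReal.ofReal (1 / (2 * Real.pi)) ≠ 0 := by
      simp [Real.pi_pos]
    rw [mul_comm, ← ENNReal.le_div_iff_mul_le (Or.inl hc0) (Or.inl ENNReal.ofReal_ne_top)]
    refine hfatou.trans (liminf_le_of_le (by isBoundedDefault) fun b hb' => ?_)
    obtain ⟨n, hn⟩ := hb'.exists
    refine hn.trans ?_
    rw [ENNReal.le_div_iff_mul_le (Or.inl hc0) (Or.inl ENNReal.ofReal_ne_top), mul_comm]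
    exact hint n
  · have hsub : Metric.closedBall (0 : ℂ) r ⊆ unitDisk := Metric.closedBall_subset_ball hr
    have hcpt := isCompact_closedBall (0 : ℂ) r
    have k1 := Metric.tendstoUniformlyOn_iff.1
      ((tendstoLocallyUniformlyOn_iff_forall_isCompact isOpen_unitDisk).1
        (hH'.deriv hhd isOpen_unitDisk) _ hsub hcpt) (ε / 2) (half_pos hε)
    have k2 := Metric.tendstoUniformlyOn_iff.1
      ((tendstoLocallyUniformlyOn_iff_forall_isCompact isOpen_unitDisk).1
        (hG.deriv hgd isOpen_unitDisk) _ hsub hcpt) (ε / 2) (half_pos hε)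
    filter_upwards [k1, k2] with n h1 h2 z hz
    have hzc : z ∈ Metric.closedBall (0 : ℂ) r := mem_closedBall_zero_iff.2 hz
    have hzd := hsub hzc
    have hn := isOpen_unitDisk.mem_nhds hzd
    have h1' := h1 z hzc
    have h2' := h2 z hzc
    rw [dist_comm, dist_eq_norm] at h1' h2'
    have hS := (S (σ₁ (σ₂ n))).sub T
    simp only [Function.comp_apply]
    rw [hS.bigLambda_eq hzd,
      deriv_sub ((S _).left.differentiableAt hn) (T.left.differentiableAt hn),
      deriv_sub ((S _).right.differentiableAt hn) (T.right.differentiableAt hn)]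
    simp only [Function.comp_apply] at h1' h2'
    linarith

/-! ### The weight -/

theorem IsMajorant.nonneg {ω : ℝ → ℝ} (hω : IsMajorant ω) {t : ℝ} (ht : 0 ≤ t) : 0 ≤ ω t :=
  hω.map_zero.symm.trans_le (hω.monotoneOn (mem_Ici.2 le_rfl) ht ht)

theorem IsMajorant.exists_le_mul {ω : ℝ → ℝ} (hω : IsMajorant ω)
    (hlim : ∃ L : ℝ, Tendsto (fun t => ω t / t) (𝓝[>] 0) (𝓝 L)) :
    ∃ L : ℝ, 0 ≤ L ∧ ∀ t, 0 < t → ω t ≤ L * t := by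
  obtain ⟨L, hL⟩ := hlim
  have h1 : ∀ t, 0 < t → ω t / t ≤ L := fun t ht => by
    refine ge_of_tendsto hL ?_
    filter_upwards [Ioc_mem_nhdsGT ht] with s hs
    exact hω.antitoneOn_div (mem_Ioi.2 hs.1) (mem_Ioi.2 ht) hs.2
  refine ⟨L, (div_nonneg (hω.nonneg zero_le_one) zero_le_one).trans (h1 1 one_pos),
    fun t ht => ?_⟩
  exact (div_le_iff₀ ht).1 (h1 t ht)

theorem one_le_log_exp_one_div {x : ℝ} (hx0 : 0 < x) (hx1 : x ≤ 1) :
    1 ≤ Real.log (Real.exp 1 / x) := by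
  rw [Real.log_div (Real.exp_pos 1).ne' hx0.ne', Real.log_exp]
  linarith [Real.log_nonpos hx0.le hx1]

/-- This is where the restriction on `α` and `β` enters: under it `x^α (log (e/x))^β = O(x)`. -/
theorem exists_rpow_mul_log_rpow_le {α β : ℝ} (hαβ : (α = 1 ∧ β ≤ 0) ∨ 1 < α) :
    ∃ K : ℝ, 0 ≤ K ∧ ∀ x, 0 < x → x ≤ 1 →
      x ^ α * Real.log (Real.exp 1 / x) ^ β ≤ K * x := by
  have hα : 1 ≤ α := by rcases hαβ with ⟨h, -⟩ | h <;> linarith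
  rcases le_or_gt β 0 with hβ | hβ
  · refine ⟨1, zero_le_one, fun x hx0 hx1 => ?_⟩
    have hl := one_le_log_exp_one_div hx0 hx1
    have h1 : x ^ α ≤ x := by
      simpa using Real.rpow_le_rpow_of_exponent_ge hx0 hx1 hα
    have h2 := Real.rpow_le_one_of_one_le_of_nonpos hl hβ
    calc _ ≤ x * 1 := by gcongr
      _ = 1 * x := by ring
  · have hα1 : 1 < α := by
      rcases hαβ with ⟨-, h⟩ | h
      · linarith
      · exact h
    set ε := (α - 1) / β with hε
    have hε0 : 0 < ε := div_pos (by linarith) hβ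
    refine ⟨Real.exp 1 ^ (α - 1) / ε ^ β, by positivity, fun x hx0 hx1 => ?_⟩
    have hl := one_le_log_exp_one_div hx0 hx1
    have hy : 0 < Real.exp 1 / x := by positivity
    have h1 : Real.log (Real.exp 1 / x) ^ β ≤ ((Real.exp 1 / x) ^ ε / ε) ^ β :=
      Real.rpow_le_rpow (by linarith) (Real.log_le_rpow_div hy.le hε0) hβ.le
    have h2 : ((Real.exp 1 / x) ^ ε / ε) ^ β = Real.exp 1 ^ (α - 1) / x ^ (α - 1) / ε ^ β := by
      rw [Real.div_rpow (by positivity) hε0.le, ← Real.rpow_mul hy.le, hε,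
        div_mul_cancel₀ _ hβ.ne', Real.div_rpow (by positivity) hx0.le]
    have h3 : x ^ α = x ^ (α - 1) * x := by
      rw [← Real.rpow_add_one hx0.ne']
      congr 1
      ring
    have h4 : x ^ (α - 1) ≠ 0 := by positivity
    calc x ^ α * Real.log (Real.exp 1 / x) ^ β
        ≤ x ^ α * (Real.exp 1 ^ (α - 1) / x ^ (α - 1) / ε ^ β) := by
          rw [← h2]
          gcongr
      _ = Real.exp 1 ^ (α - 1) / ε ^ β * x := by
          rw [h3]
          field_simp

theorem blochWeight_nonneg {ω : ℝ → ℝ} (hω : IsMajorant ω) (α β : ℝ) {z : ℂ}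
    (hz : z ∈ unitDisk) : 0 ≤ blochWeight ω α β z := by
  have h0 := one_sub_norm_sq_pos hz
  have hl := one_le_log_exp_one_div h0 (by nlinarith [norm_nonneg z])
  exact hω.nonneg (mul_nonneg (by positivity) (Real.rpow_nonneg (by linarith) β))

theorem exists_blochWeight_le {ω : ℝ → ℝ} (hω : IsMajorant ω)
    (hlim : ∃ L : ℝ, Tendsto (fun t => ω t / t) (𝓝[>] 0) (𝓝 L)) {α β : ℝ}
    (hαβ : (α = 1 ∧ β ≤ 0) ∨ 1 < α) :
    ∃ K : ℝ, 0 ≤ K ∧ ∀ z ∈ unitDisk, blochWeight ω α β z ≤ K * (1 - ‖z‖ ^ 2) := by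
  obtain ⟨L, hL0, hL⟩ := hω.exists_le_mul hlim
  obtain ⟨K, hK0, hK⟩ := exists_rpow_mul_log_rpow_le hαβ
  refine ⟨L * K, mul_nonneg hL0 hK0, fun z hz => ?_⟩
  have h0 := one_sub_norm_sq_pos hz
  have h1 : 1 - ‖z‖ ^ 2 ≤ 1 := by nlinarith [norm_nonneg z]
  have hl := one_le_log_exp_one_div h0 h1
  have hpos : 0 < (1 - ‖z‖ ^ 2) ^ α * Real.log (Real.exp 1 / (1 - ‖z‖ ^ 2)) ^ β :=
    mul_pos (by positivity) (Real.rpow_pos_of_pos (by linarith) β)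
  calc blochWeight ω α β z ≤ L * _ := hL _ hpos
    _ ≤ L * (K * (1 - ‖z‖ ^ 2)) := mul_le_mul_of_nonneg_left (hK _ h0 h1) hL0
    _ = _ := by ring

/-- The Schwarz lemma on the largest disk about `z` inside the unit disk. The sharp constant of the
Schwarz–Pick lemma is not needed. -/
theorem norm_deriv_mul_one_sub_norm_sq_le {φ : ℂ → ℂ} (hφ : DifferentiableOn ℂ φ unitDisk)
    (hmaps : MapsTo φ unitDisk unitDisk) {z : ℂ} (hz : z ∈ unitDisk) :
    ‖deriv φ z‖ * (1 - ‖z‖ ^ 2) ≤ 4 := by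
  have hz1 : 0 < 1 - ‖z‖ := by linarith [mem_unitDisk.1 hz]
  have hsub : Metric.ball z (1 - ‖z‖) ⊆ unitDisk :=
    Metric.ball_subset_ball' (by rw [dist_zero_right]; linarith)
  have h1 : ‖deriv φ z‖ ≤ 2 / (1 - ‖z‖) := by
    refine Complex.norm_deriv_le_div_of_mapsTo_ball (hφ.mono hsub) (fun w hw => ?_) hz1
    rw [mem_closedBall_iff_norm]
    have h2 := mem_unitDisk.1 (hmaps (hsub hw))
    have h3 := mem_unitDisk.1 (hmaps hz)
    linarith [norm_sub_le (φ w) (φ z)]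
  calc ‖deriv φ z‖ * (1 - ‖z‖ ^ 2) ≤ 2 / (1 - ‖z‖) * (2 * (1 - ‖z‖)) := by
        have := one_sub_norm_sq_le hz
        have := (one_sub_norm_sq_pos hz).le
        gcongr
    _ = 4 := by field_simp; norm_num

theorem exists_norm_deriv_mul_blochWeight_le {ω : ℝ → ℝ} (hω : IsMajorant ω)
    (hlim : ∃ L : ℝ, Tendsto (fun t => ω t / t) (𝓝[>] 0) (𝓝 L)) {α β : ℝ}
    (hαβ : (α = 1 ∧ β ≤ 0) ∨ 1 < α) {φ : ℂ → ℂ} (hφ : DifferentiableOn ℂ φ unitDisk)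
    (hmaps : MapsTo φ unitDisk unitDisk) :
    ∃ K : ℝ, 0 ≤ K ∧ ∀ z ∈ unitDisk, ‖deriv φ z‖ * blochWeight ω α β z ≤ K := by
  obtain ⟨K, hK0, hK⟩ := exists_blochWeight_le hω hlim hαβ
  refine ⟨K * 4, by positivity, fun z hz => ?_⟩
  calc ‖deriv φ z‖ * blochWeight ω α β z ≤ ‖deriv φ z‖ * (K * (1 - ‖z‖ ^ 2)) := by
        gcongr
        exact hK z hz
    _ = K * (‖deriv φ z‖ * (1 - ‖z‖ ^ 2)) := by ring
    _ ≤ K * 4 := by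
        gcongr
        exact norm_deriv_mul_one_sub_norm_sq_le hφ hmaps hz

theorem compQuantity_nonneg {ω : ℝ → ℝ} (hω : IsMajorant ω) (p α β : ℝ) {φ : ℂ → ℂ}
    (hmaps : MapsTo φ unitDisk unitDisk) {z : ℂ} (hz : z ∈ unitDisk) :
    0 ≤ compQuantity p ω α β φ z := by
  have h0 := one_sub_norm_sq_pos (hmaps hz)
  have := blochWeight_nonneg hω α β hz
  unfold compQuantity
  positivity

/-- Away from the boundary of the image disk the quantity is always bounded, so that only its
behaviour for `|φ z|` near `1` matters. -/
theorem compQuantity_le_of_norm_le {p : ℝ} (hp : 0 < p) {ω : ℝ → ℝ} {α β : ℝ} {φ : ℂ → ℂ} {K r : ℝ}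
    (hK0 : 0 ≤ K) (hK : ∀ z ∈ unitDisk, ‖deriv φ z‖ * blochWeight ω α β z ≤ K) (hr1 : r < 1)
    {z : ℂ} (hz : z ∈ unitDisk) (hzr : ‖φ z‖ ≤ r) :
    compQuantity p ω α β φ z ≤ K / (1 - r ^ 2) ^ (1 + 1 / p) := by
  have hr0 : 0 ≤ r := (norm_nonneg _).trans hzr
  have h1 : 0 < 1 - r ^ 2 := by nlinarith
  unfold compQuantity
  gcongr
  exact hK z hz

/-! ### Boundedness and compactness -/

theorem bigLambda_mul_blochWeight_le_blochNorm (ω : ℝ → ℝ) (α β : ℝ) (f : ℂ → ℂ) {z : ℂ}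
    (hz : z ∈ unitDisk) :
    ENNReal.ofReal (bigLambda f z * blochWeight ω α β z) ≤ blochNorm ω α β f :=
  (le_iSup₂ (f := fun z (_ : z ∈ unitDisk) =>
    ENNReal.ofReal (bigLambda f z * blochWeight ω α β z)) z hz).trans le_add_self

/-- The central estimate for `Λ` of a composition, in terms of the test quantity. -/
theorem bigLambda_compOp_mul_le {p M : ℝ} (hp : 1 ≤ p) (hM : 0 ≤ M) {ω : ℝ → ℝ}
    (hω : IsMajorant ω) (α β : ℝ) {φ : ℂ → ℂ} (hφ : DifferentiableOn ℂ φ unitDisk)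
    (hmaps : MapsTo φ unitDisk unitDisk) {f : ℂ → ℂ} (hf : IsHarmonicOnDisk f)
    (h : hardyNorm p f ≤ ENNReal.ofReal M) {z : ℂ} (hz : z ∈ unitDisk) :
    bigLambda (compOp φ f) z * blochWeight ω α β z ≤
      256 * M * compQuantity p ω α β φ z := by
  have h1 := bigLambda_le_of_hardyNorm_le hp hM hf h (hmaps hz)
  have h2 := blochWeight_nonneg hω α β hz
  rw [bigLambda_compOp hf hφ hmaps hz, compQuantity]
  calc bigLambda f (φ z) * ‖deriv φ z‖ * blochWeight ω α β z
      ≤ 256 * M / (1 - ‖φ z‖ ^ 2) ^ (1 + 1 / p) * ‖deriv φ z‖ * blochWeight ω α β z := by gcongr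
    _ = _ := by ring

theorem blochNorm_compOp_le {p M B : ℝ} (hp : 1 ≤ p) (hM : 0 ≤ M) {ω : ℝ → ℝ}
    (hω : IsMajorant ω) {α β : ℝ} {φ : ℂ → ℂ} (hφ : DifferentiableOn ℂ φ unitDisk)
    (hmaps : MapsTo φ unitDisk unitDisk) (hB : ∀ z ∈ unitDisk, compQuantity p ω α β φ z ≤ B)
    {f : ℂ → ℂ} (hf : IsHarmonicOnDisk f) (h : hardyNorm p f ≤ ENNReal.ofReal M) :
    blochNorm ω α β (compOp φ f) ≤
      ENNReal.ofReal (2 * (4 / (1 - ‖φ 0‖)) ^ (1 / p) + 256 * B) * ENNReal.ofReal M := by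
  have h0 : (0 : ℂ) ∈ unitDisk := mem_unitDisk.2 (by simp)
  have hφ0 : 0 < 1 - ‖φ 0‖ := by linarith [mem_unitDisk.1 (hmaps h0)]
  have hB0 : 0 ≤ B := (compQuantity_nonneg hω p α β hmaps h0).trans (hB 0 h0)
  rw [← ENNReal.ofReal_mul (by positivity), add_mul, ENNReal.ofReal_add (by positivity)
    (by positivity)]
  refine add_le_add ?_ (iSup₂_le fun z hz => ENNReal.ofReal_le_ofReal ?_)
  · rw [← ofReal_norm]
    exact ENNReal.ofReal_le_ofReal (norm_le_of_hardyNorm_le hp hM hf h (hmaps h0))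
  · calc _ ≤ 256 * M * compQuantity p ω α β φ z :=
          bigLambda_compOp_mul_le hp hM hω α β hφ hmaps hf h hz
      _ ≤ 256 * M * B := by
          gcongr
          exact hB z hz
      _ = 256 * B * M := by ring

theorem isBoundedOp_of_compQuantity_le {p B : ℝ} (hp : 1 ≤ p) {ω : ℝ → ℝ}
    (hω : IsMajorant ω) {α β : ℝ} {φ : ℂ → ℂ} (hφ : DifferentiableOn ℂ φ unitDisk)
    (hmaps : MapsTo φ unitDisk unitDisk) (hB : ∀ z ∈ unitDisk, compQuantity p ω α β φ z ≤ B) :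
    IsBoundedOp (harmonicHardy p) (hardyNorm p) (harmonicBloch ω α β) (blochNorm ω α β)
      (compOp φ) := by
  have key : ∀ f ∈ harmonicHardy p, blochNorm ω α β (compOp φ f) ≤
      (2 * (4 / (1 - ‖φ 0‖)) ^ (1 / p) + 256 * B).toNNReal * hardyNorm p f := fun f hf => by
    have h1 : ENNReal.ofReal (hardyNorm p f).toReal = hardyNorm p f :=
      ENNReal.ofReal_toReal hf.2.ne
    have h2 := blochNorm_compOp_le hp ENNReal.toReal_nonneg hω hφ hmaps hB hf.1 h1.ge
    rwa [h1] at h2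
  refine ⟨fun f hf => ⟨?_, ?_⟩, _, key⟩
  · obtain ⟨h, g, S, -⟩ := exists_isHarmonicSplitting hf.1
    exact (S.compOp hφ hmaps).isHarmonicOnDisk
  · exact (key f hf).trans_lt (ENNReal.mul_lt_top ENNReal.coe_lt_top hf.2)

theorem bigLambda_compOp_hardyTestFun_mul {p : ℝ} (hp : 0 < p) (ω : ℝ → ℝ) (α β : ℝ) {φ : ℂ → ℂ}
    (hφ : DifferentiableOn ℂ φ unitDisk) (hmaps : MapsTo φ unitDisk unitDisk) {z : ℂ}
    (hz : z ∈ unitDisk) :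
    bigLambda (compOp φ (hardyTestFun p (φ z))) z * blochWeight ω α β z =
      2 / p * ‖φ z‖ * compQuantity p ω α β φ z := by
  have ha := mem_unitDisk.1 (hmaps hz)
  rw [bigLambda_compOp (hardyTestFun_mem hp ha).1 hφ hmaps hz, bigLambda_hardyTestFun_self hp ha,
    compQuantity]
  ring

theorem exists_compQuantity_le_of_isBoundedOp {p : ℝ} (hp : 0 < p) {ω : ℝ → ℝ}
    (hω : IsMajorant ω) {α β : ℝ} {φ : ℂ → ℂ} (hφ : DifferentiableOn ℂ φ unitDisk)
    (hmaps : MapsTo φ unitDisk unitDisk) {K : ℝ} (hK0 : 0 ≤ K)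
    (hK : ∀ z ∈ unitDisk, ‖deriv φ z‖ * blochWeight ω α β z ≤ K)
    (h : IsBoundedOp (harmonicHardy p) (hardyNorm p) (harmonicBloch ω α β) (blochNorm ω α β)
      (compOp φ)) :
    ∃ B, ∀ z ∈ unitDisk, compQuantity p ω α β φ z ≤ B := by
  obtain ⟨-, C, hC⟩ := h
  refine ⟨max (K / (1 - (1 / 2) ^ 2) ^ (1 + 1 / p)) (p * C), fun z hz => ?_⟩
  -- the test function at `φ z` degenerates as `φ z → 0`
  rcases le_total ‖φ z‖ (1 / 2) with hs | hs
  · exact le_max_of_le_left (compQuantity_le_of_norm_le hp hK0 hK (by norm_num) hz hs)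
  · have ha := mem_unitDisk.1 (hmaps hz)
    have hQ := compQuantity_nonneg hω p α β hmaps hz
    have h1 : ENNReal.ofReal (2 / p * ‖φ z‖ * compQuantity p ω α β φ z) ≤ C := by
      rw [← bigLambda_compOp_hardyTestFun_mul hp ω α β hφ hmaps hz]
      refine ((bigLambda_mul_blochWeight_le_blochNorm ω α β _ hz).trans
        (hC _ (hardyTestFun_mem hp ha))).trans ?_
      have h2 := hardyNorm_hardyTestFun_le hp ha
      rw [ENNReal.ofReal_one] at h2
      calc (C : ℝ≥0∞) * hardyNorm p (hardyTestFun p (φ z)) ≤ C * 1 := by gcongr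
        _ = C := mul_one _
    rw [← ENNReal.ofReal_coe_nnreal, ENNReal.ofReal_le_ofReal_iff C.coe_nonneg] at h1
    refine le_max_of_le_right ?_
    have h3 : 1 / p * compQuantity p ω α β φ z ≤ C := by
      refine le_trans ?_ h1
      have : 1 / p ≤ 2 / p * ‖φ z‖ := by
        rw [div_mul_eq_mul_div]
        gcongr
        linarith
      gcongr
    rw [div_mul_eq_mul_div, one_mul, div_le_iff₀ hp] at h3
    linarith

theorem exists_compQuantity_le_of_forall_lt {p : ℝ} (hp : 0 < p) {ω : ℝ → ℝ} {α β : ℝ}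
    {φ : ℂ → ℂ} {K : ℝ} (hK0 : 0 ≤ K)
    (hK : ∀ z ∈ unitDisk, ‖deriv φ z‖ * blochWeight ω α β z ≤ K)
    (h : ∀ ε : ℝ, 0 < ε → ∃ r : ℝ, r < 1 ∧
      ∀ z ∈ unitDisk, r < ‖φ z‖ → compQuantity p ω α β φ z < ε) :
    ∃ B, ∀ z ∈ unitDisk, compQuantity p ω α β φ z ≤ B := by
  obtain ⟨r, hr1, hr⟩ := h 1 one_pos
  refine ⟨max (K / (1 - r ^ 2) ^ (1 + 1 / p)) 1, fun z hz => ?_⟩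
  rcases le_or_gt ‖φ z‖ r with hs | hs
  · exact le_max_of_le_left (compQuantity_le_of_norm_le hp hK0 hK hr1 hz hs)
  · exact le_max_of_le_right (hr z hz hs).le

/-- A bounded sequence `u` has a subsequence converging locally uniformly to some `f`, together with
its gradients. In the Bloch type norm of `(u - f) ∘ φ`, the points with `|φ z| ≤ r` are controlled
by this convergence, and those with `|φ z| > r` by the smallness of the test quantity. -/
theorem isCompactOp_of_forall_compQuantity_lt {p : ℝ} (hp : 1 ≤ p) {ω : ℝ → ℝ}
    (hω : IsMajorant ω) {α β : ℝ} {φ : ℂ → ℂ} (hφ : DifferentiableOn ℂ φ unitDisk)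
    (hmaps : MapsTo φ unitDisk unitDisk) {K : ℝ} (hK0 : 0 ≤ K)
    (hK : ∀ z ∈ unitDisk, ‖deriv φ z‖ * blochWeight ω α β z ≤ K)
    (h : ∀ ε : ℝ, 0 < ε → ∃ r : ℝ, r < 1 ∧
      ∀ z ∈ unitDisk, r < ‖φ z‖ → compQuantity p ω α β φ z < ε) :
    IsCompactOp (harmonicHardy p) (hardyNorm p) (harmonicBloch ω α β) (blochNorm ω α β)
      (compOp φ) := by
  have hp0 : 0 < p := by linarith
  obtain ⟨B, hB⟩ := exists_compQuantity_le_of_forall_lt hp0 hK0 hK h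
  have hmap := (isBoundedOp_of_compQuantity_le hp hω hφ hmaps hB).1
  refine ⟨hmap, fun u hu ⟨M, hM⟩ => ?_⟩
  have hM' : ∀ n, hardyNorm p (u n) ≤ ENNReal.ofReal M := fun n => by
    rw [ENNReal.ofReal_coe_nnreal]
    exact hM n
  obtain ⟨f, hf, hfM, σ, hσ, hpt, hloc⟩ :=
    exists_subseq_of_hardyNorm_le hp M.coe_nonneg (fun n => (hu n).1) hM'
  refine ⟨compOp φ f, hmap ⟨hf, hfM.trans_lt ENNReal.ofReal_lt_top⟩, σ, hσ, ?_⟩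
  have h0 : (0 : ℂ) ∈ unitDisk := mem_unitDisk.2 (by simp)
  have hu0 : Tendsto (fun n => ‖u (σ n) (φ 0) - f (φ 0)‖) atTop (𝓝 0) := by
    have h1 := ((hpt _ (hmaps h0)).sub_const (f (φ 0))).norm
    simpa using h1
  rw [ENNReal.tendsto_nhds_zero]
  intro ε hε
  obtain ⟨δ, hδ0, hδ⟩ : ∃ δ : ℝ, 0 < δ ∧ ENNReal.ofReal δ + ENNReal.ofReal δ ≤ ε := by
    obtain ⟨δ, hδ0, hδ⟩ := ENNReal.lt_iff_exists_nnreal_btwn.1 hε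
    have hδ0' : (0 : ℝ) < δ := by exact_mod_cast hδ0
    refine ⟨δ / 2, by positivity, ?_⟩
    rw [← ENNReal.ofReal_add (by positivity) (by positivity), add_halves,
      ENNReal.ofReal_coe_nnreal]
    exact hδ.le
  have hM1 : (0 : ℝ) < 512 * M + 1 := by positivity
  obtain ⟨r, hr1, hr⟩ := h (δ / (512 * M + 1)) (by positivity)
  filter_upwards [hu0.eventually_lt_const hδ0, hloc r hr1 (δ / (K + 1)) (by positivity)]
    with n hn0 hn
  refine le_trans (add_le_add ?_ (iSup₂_le fun z hz => ENNReal.ofReal_le_ofReal ?_)) hδ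
  · rw [← ofReal_norm]
    exact ENNReal.ofReal_le_ofReal hn0.le
  · have hw := blochWeight_nonneg hω α β hz
    rcases le_or_gt ‖φ z‖ r with hs | hs
    · have e1 : compOp φ (u (σ n)) - compOp φ f = compOp φ (u (σ n) - f) := rfl
      rw [e1, bigLambda_compOp (InnerProductSpace.HarmonicOnNhd.sub (hu _).1 hf) hφ hmaps hz,
        mul_assoc]
      have hK1 : (0 : ℝ) < K + 1 := by positivity
      calc _ ≤ δ / (K + 1) * K := by
            have := hn _ hs
            have := hK z hz
            gcongr
        _ ≤ δ / (K + 1) * (K + 1) := by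
            gcongr
            linarith
        _ = δ := div_mul_cancel₀ _ hK1.ne'
    · have hQ := compQuantity_nonneg hω p α β hmaps hz
      have hc : ∀ {v : ℂ → ℂ}, IsHarmonicOnDisk v → IsHarmonicOnDisk (compOp φ v) := fun hv => by
        obtain ⟨a, b, S, -⟩ := exists_isHarmonicSplitting hv
        exact (S.compOp hφ hmaps).isHarmonicOnDisk
      have b1 := bigLambda_compOp_mul_le hp M.coe_nonneg hω α β hφ hmaps (hu (σ n)).1 (hM' (σ n)) hz
      have b2 := bigLambda_compOp_mul_le hp M.coe_nonneg hω α β hφ hmaps hf hfM hz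
      have b3 := bigLambda_sub_le (hc (hu (σ n)).1) (hc hf) hz
      have b4 := (lt_div_iff₀ hM1).1 (hr z hz hs)
      calc _ ≤ (bigLambda (compOp φ (u (σ n))) z + bigLambda (compOp φ f) z) *
            blochWeight ω α β z := by gcongr
        _ ≤ δ := by
            rw [add_mul]
            linarith

/-- Otherwise the quantity stays above some `ε` at points `z n` with `|φ (z n)| → 1`. The images of
the test functions with poles `φ (z n)` have a subsequence converging to some `G`. Their gradients
tend to `0` pointwise, so `Λ` of `G` times the weight vanishes identically, and the norm of the
difference bounds `Λ` of the image at `z n` times the weight, which is at least a multiple of `ε`. -/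
theorem forall_compQuantity_lt_of_isCompactOp {p : ℝ} (hp : 0 < p) {ω : ℝ → ℝ}
    (hω : IsMajorant ω) {α β : ℝ} {φ : ℂ → ℂ} (hφ : DifferentiableOn ℂ φ unitDisk)
    (hmaps : MapsTo φ unitDisk unitDisk)
    (h : IsCompactOp (harmonicHardy p) (hardyNorm p) (harmonicBloch ω α β) (blochNorm ω α β)
      (compOp φ)) :
    ∀ ε : ℝ, 0 < ε → ∃ r : ℝ, r < 1 ∧
      ∀ z ∈ unitDisk, r < ‖φ z‖ → compQuantity p ω α β φ z < ε := by
  by_contra! hcon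
  obtain ⟨ε, hε, hcon⟩ := hcon
  have hseq : ∀ n : ℕ, (1 : ℝ) - 1 / (n + 1) < 1 := fun n => by
    have : (0 : ℝ) < 1 / (n + 1) := by positivity
    linarith
  choose z hz hφz hQ using fun n => hcon _ (hseq n)
  have ha : ∀ n, ‖φ (z n)‖ < 1 := fun n => mem_unitDisk.1 (hmaps (hz n))
  have hlim : Tendsto (fun n => ‖φ (z n)‖) atTop (𝓝 1) := by
    have h1 : Tendsto (fun n : ℕ => (1 : ℝ) - 1 / (n + 1)) atTop (𝓝 (1 - 0)) :=
      tendsto_one_div_add_atTop_nhds_zero_nat.const_sub 1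
    rw [sub_zero] at h1
    exact tendsto_of_tendsto_of_tendsto_of_le_of_le h1 tendsto_const_nhds
      (fun n => (hφz n).le) fun n => (ha n).le
  obtain ⟨G, hG, σ, hσ, hconv⟩ := h.2 (fun n => hardyTestFun p (φ (z n)))
    (fun n => hardyTestFun_mem hp (ha n))
    ⟨1, fun n => by simpa using hardyNorm_hardyTestFun_le hp (ha n)⟩
  set T : ℕ → ℂ → ℂ := fun n => compOp φ (hardyTestFun p (φ (z (σ n)))) with hT
  have hTh : ∀ n, IsHarmonicOnDisk (T n) := fun n =>
    (h.1 (hardyTestFun_mem hp (ha (σ n)))).1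
  have hdist : ∀ n, ∀ x ∈ unitDisk,
      ENNReal.ofReal (bigLambda (T n - G) x * blochWeight ω α β x) ≤ blochNorm ω α β (T n - G) :=
    fun n x hx => bigLambda_mul_blochWeight_le_blochNorm ω α β _ hx
  have hG0 : ∀ x ∈ unitDisk, bigLambda G x * blochWeight ω α β x = 0 := fun x hx => by
    have hw := blochWeight_nonneg hω α β hx
    have h1 : Tendsto (fun n => bigLambda (T n) x * blochWeight ω α β x) atTop (𝓝 0) := by
      have h2 := (tendsto_bigLambda_hardyTestFun hp (fun n => ha (σ n))
        (hlim.comp hσ.tendsto_atTop) (mem_unitDisk.1 (hmaps hx))).mul_const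
          (‖deriv φ x‖ * blochWeight ω α β x)
      rw [zero_mul] at h2
      refine h2.congr fun n => ?_
      rw [hT, bigLambda_compOp (hardyTestFun_mem hp (ha (σ n))).1 hφ hmaps hx, mul_assoc]
    have h3 : ∀ n, ENNReal.ofReal (bigLambda G x * blochWeight ω α β x) ≤
        ENNReal.ofReal (bigLambda (T n) x * blochWeight ω α β x) +
          blochNorm ω α β (T n - G) := fun n => by
      refine le_trans ?_ (add_le_add le_rfl (hdist n x hx))
      rw [← ENNReal.ofReal_add (mul_nonneg (bigLambda_nonneg _ _) hw)
        (mul_nonneg (bigLambda_nonneg _ _) hw), ← add_mul]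
      have h4 := bigLambda_sub_le (hTh n)
        (InnerProductSpace.HarmonicOnNhd.sub (hTh n) hG.1) hx
      rw [sub_sub_cancel] at h4
      gcongr
    have h5 := (ENNReal.tendsto_ofReal h1).add hconv
    rw [ENNReal.ofReal_zero, add_zero] at h5
    have h6 := ge_of_tendsto' h5 h3
    exact le_antisymm (ENNReal.ofReal_eq_zero.1 (le_antisymm h6 zero_le))
      (mul_nonneg (bigLambda_nonneg _ _) hw)
  have hlow : ∀ n, ENNReal.ofReal (2 / p * ‖φ (z (σ n))‖ * ε) ≤ blochNorm ω α β (T n - G) :=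
    fun n => by
    refine le_trans (ENNReal.ofReal_le_ofReal ?_) (hdist n (z (σ n)) (hz (σ n)))
    have hw := blochWeight_nonneg hω α β (hz (σ n))
    have h1 := bigLambda_compOp_hardyTestFun_mul hp ω α β hφ hmaps (hz (σ n))
    have h2 := bigLambda_sub_le
      (InnerProductSpace.HarmonicOnNhd.sub (hTh n) hG.1)
      (InnerProductSpace.HarmonicOnNhd.neg hG.1) (hz (σ n))
    have h3 : bigLambda (-G) (z (σ n)) * blochWeight ω α β (z (σ n)) = 0 := by
      have h4 : bigLambda (-G) (z (σ n)) = bigLambda G (z (σ n)) := by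
        simp only [bigLambda, dz, dzbar, fderiv_neg, neg_apply]
        congr 1
        · rw [← norm_neg]
          congr 1
          ring
        · rw [← norm_neg]
          congr 1
          ring
      rw [h4]
      exact hG0 _ (hz (σ n))
    rw [sub_neg_eq_add, sub_add_cancel] at h2
    calc 2 / p * ‖φ (z (σ n))‖ * ε
        ≤ 2 / p * ‖φ (z (σ n))‖ * compQuantity p ω α β φ (z (σ n)) := by
          gcongr
          exact hQ (σ n)
      _ = bigLambda (T n) (z (σ n)) * blochWeight ω α β (z (σ n)) := h1.symm
      _ ≤ (bigLambda (T n - G) (z (σ n)) + bigLambda (-G) (z (σ n))) *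
            blochWeight ω α β (z (σ n)) := by gcongr
      _ = _ := by rw [add_mul, h3, add_zero]
  have h7 : Tendsto (fun n => ENNReal.ofReal (2 / p * ‖φ (z (σ n))‖ * ε)) atTop
      (𝓝 (ENNReal.ofReal (2 / p * 1 * ε))) :=
    ENNReal.tendsto_ofReal (((hlim.comp hσ.tendsto_atTop).const_mul (2 / p)).mul_const ε)
  have h8 := le_of_tendsto_of_tendsto' h7 hconv hlow
  rw [nonpos_iff_eq_zero, ENNReal.ofReal_eq_zero] at h8
  have : 0 < 2 / p * 1 * ε := by positivity
  linarith

theorem mainTheorem4 (p : ℝ) (hp : 1 < p) (ω : ℝ → ℝ) (hω : IsMajorant ω)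
    (hlim : ∃ L : ℝ, Tendsto (fun t => ω t / t) (𝓝[>] 0) (𝓝 L))
    (φ : ℂ → ℂ) (hφ : AnalyticOnNhd ℂ φ unitDisk) (hmaps : MapsTo φ unitDisk unitDisk)
    (α β : ℝ) (hαβ : (α = 1 ∧ β ≤ 0) ∨ 1 < α) :
    (IsBoundedOp (harmonicHardy p) (hardyNorm p) (harmonicBloch ω α β) (blochNorm ω α β)
        (compOp φ) ↔
      BddAbove (compQuantity p ω α β φ '' unitDisk)) ∧
    (IsCompactOp (harmonicHardy p) (hardyNorm p) (harmonicBloch ω α β) (blochNorm ω α β)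
        (compOp φ) ↔
      ∀ ε : ℝ, 0 < ε → ∃ r : ℝ, r < 1 ∧
        ∀ z ∈ unitDisk, r < ‖φ z‖ → compQuantity p ω α β φ z < ε) := by
  have hp0 : 0 < p := by linarith
  have hd : DifferentiableOn ℂ φ unitDisk := hφ.differentiableOn
  obtain ⟨K, hK0, hK⟩ := exists_norm_deriv_mul_blochWeight_le hω hlim hαβ hd hmaps
  refine ⟨⟨fun h => ?_, fun ⟨B, hB⟩ => ?_⟩,
    ⟨forall_compQuantity_lt_of_isCompactOp hp0 hω hd hmaps,
      isCompactOp_of_forall_compQuantity_lt hp.le hω hd hmaps hK0 hK⟩⟩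
  · obtain ⟨B, hB⟩ := exists_compQuantity_le_of_isBoundedOp hp0 hω hd hmaps hK0 hK h
    exact ⟨B, forall_mem_image.2 hB⟩
  · exact isBoundedOp_of_compQuantity_le hp.le hω hd hmaps fun z hz => hB (mem_image_of_mem _ hz)
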